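/- For $k\ge 1$, a univariate Gaussian mixture with $k$ components is a distribution $\mathcal D=\sum_{i=1}^k w_i\,\mathcal N(\mu_i,\sigma_i^2)$ on $\mathbb R$, represented by its parameters $\{(w_i,\mu_i,\sigma_i^2)\}_{i=1}^k$, where $w_i\ge 0$, $\sum_i w_i=1$, $\mu_i\in\mathbb R$ and $\sigma_i^2>0$ (zero weights are allowed, so mixtures of fewer than $k$ Gaussians are included). For two such mixtures with densities $\mathcal D(x),\tilde{\mathcal D}(x)$, let $\mathrm{TV}(\tilde{\mathcal D},\mathcal D)=\frac12\int_{\mathbb R}|\tilde{\mathcal D}(x)-\mathcal D(x)|\,dx$. Theorem. There are universal constants $C,c>0$ such that for all $\alpha,\varepsilon,\delta\in(0,1)$ and every integer $k\ge1$ there are an integer $$n\;\le\; C\left(\frac{k}{\alpha^2}+\frac{k\log(1/\delta)}{\alpha\varepsilon}\right)\log^{c}\!\left(2+k+\frac1\alpha+\frac1\varepsilon+\log\frac1\delta\right)$$ and a randomized algorithm $\mathcal A$ which takes a dataset in $\mathbb R^n$ and outputs a representation of a univariate Gaussian mixture with $k$ components, such that 1. (privacy) $\mathcal A$ is $(\varepsilon,\delta)$-differentially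 private: for any two datasets $\mathbf X,\mathbf X'\in\mathbb R^n$ that differ in at most one entry, and any measurable set $O$ of outputs, $\mathbb P[\mathcal A(\mathbf X')\in O]\le e^{\varepsilon}\,\mathbb P[\mathcal A(\mathbf X)\in O]+\delta$; 2. (accuracy) for every univariate Gaussian mixture $\mathcal D$ with $k$ components, if $X_1,\dots,X_n$ are i.i.d. samples from $\mathcal D$, then $\tilde{\mathcal D}=\mathcal A(X_1,\dots,X_n)$ satisfies $\mathrm{TV}(\tilde{\mathcal D},\mathcal D)\le\alpha$ with probability at least $2/3$ over the samples and the randomness of $\mathcal A$. That is, $n=\widetilde O\!\left(\frac{k}{\alpha^2}+\frac{k\log(1/\delta)}{\alpha\varepsilon}\right)$ samples suffice, which up to logarithmic factors is linear in $k$. -/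

import Mathlib

open MeasureTheory ProbabilityTheory
open scoped NNReal ENNReal

noncomputable section

/-- A representation `{(w_i, μ_i, σ_i²)}` of a univariate Gaussian mixture with `k` components:
the weights are nonnegative and sum to one, and the variances are nonzero. Weights may vanish, so
mixtures of fewer than `k` (but at least one) Gaussians are represented as well. -/
structure GMM (k : ℕ) where
  weight : Fin k → ℝ
  mean : Fin k → ℝ
  var : Fin k → ℝ≥0
  weight_nonneg : ∀ i, 0 ≤ weight i
  weight_sum : ∑ i, weight i = 1
  var_pos : ∀ i, 0 < var i

namespace GMM

/-- The Borel σ-algebra of the parameter space. -/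
instance instMeasurableSpace (k : ℕ) : MeasurableSpace (GMM k) :=
  MeasurableSpace.comap (fun D : GMM k => (D.weight, D.mean, D.var)) inferInstance

variable {k : ℕ}

/-- The density `x ↦ ∑ w_i N(μ_i, σ_i²)(x)` of the mixture. -/
def density (D : GMM k) (x : ℝ) : ℝ :=
  ∑ i, D.weight i * gaussianPDFReal (D.mean i) (D.var i) x

/-- The mixture `∑ w_i N(μ_i, σ_i²)` as a measure on the real line. -/
def law (D : GMM k) : Measure ℝ :=
  ∑ i, ENNReal.ofReal (D.weight i) • gaussianReal (D.mean i) (D.var i)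

instance instIsProbabilityMeasureLaw (D : GMM k) : IsProbabilityMeasure D.law := by
  constructor
  simp only [law, Measure.finsetSum_apply, Measure.smul_apply, measure_univ, smul_eq_mul, mul_one]
  rw [← ENNReal.ofReal_sum_of_nonneg (fun i _ => D.weight_nonneg i), D.weight_sum,
    ENNReal.ofReal_one]

/-- `density` is the density of `law` with respect to Lebesgue measure. -/
theorem law_eq_withDensity (D : GMM k) :
    D.law = volume.withDensity (fun x => ENNReal.ofReal (D.density x)) := by
  ext s hs
  have h : ∀ x, ENNReal.ofReal (D.density x)
      = ∑ i, ENNReal.ofReal (D.weight i) * gaussianPDF (D.mean i) (D.var i) x := by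
    intro x
    rw [density, ENNReal.ofReal_sum_of_nonneg
      (fun i _ => mul_nonneg (D.weight_nonneg i) (gaussianPDFReal_nonneg _ _ _))]
    exact Finset.sum_congr rfl fun i _ => ENNReal.ofReal_mul (D.weight_nonneg i)
  rw [withDensity_apply _ hs]
  simp_rw [h]
  rw [lintegral_finsetSum _ (fun i _ => (measurable_gaussianPDF _ _).const_mul _)]
  simp only [law, Measure.finsetSum_apply, Measure.smul_apply, smul_eq_mul]
  refine Finset.sum_congr rfl fun i _ => ?_
  rw [gaussianReal_apply _ (D.var_pos i).ne', lintegral_const_mul _ (measurable_gaussianPDF _ _)]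

/-- Total variation distance between two mixtures, `(1/2) ∫ |D(x) - D'(x)| dx`. -/
def tvDist (D D' : GMM k) : ℝ :=
  (1 / 2) * ∫ x, |D.density x - D'.density x|

end GMM

/-- Two datasets of size `n` are neighboring if they differ in at most one entry. -/
def Neighboring {X : Type*} {n : ℕ} (x x' : Fin n → X) : Prop :=
  ∃ j, ∀ i, i ≠ j → x i = x' i

/-- `(ε, δ)`-differential privacy of a randomized algorithm, given as a kernel that sends a
dataset to the distribution of the output. -/
def IsDP {X O : Type*} [MeasurableSpace X] [MeasurableSpace O] {n : ℕ}
    (A : Kernel (Fin n → X) O) (ε δ : ℝ) : Prop :=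
  ∀ x x' : Fin n → X, Neighboring x x' → ∀ S : Set O, MeasurableSet S →
    A x' S ≤ ENNReal.ofReal (Real.exp ε) * A x S + ENNReal.ofReal δ

/-- The randomized algorithm `A` learns univariate mixtures of (up to) `k` Gaussians from `n`
i.i.d. samples up to accuracy `α` with failure probability `β`. The probability is over both the
data and the algorithm. -/
def LearnsGMM {k n : ℕ} (A : Kernel (Fin n → ℝ) (GMM k)) (α β : ℝ) : Prop :=
  ∀ D : GMM k,
    ENNReal.ofReal (1 - β) ≤
      ((Measure.pi fun _ : Fin n => D.law).bind A) {H | GMM.tvDist H D ≤ α}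

end

/-! ### Densities and total variation of Gaussian mixtures -/

namespace GMM

variable {k : ℕ}

/-! The sample is split in two. The first part only has to find, privately, where each
non-negligible component lives, up to factors polynomial in the sample size; the second part then
selects among finitely many mixtures.

Locating. Attach to each sample its distance to the next one on the line. For a component of
standard deviation σ and weight at least 1/K, with K about k/α, it is likely that no other sample
lies within σ/(40n²) of any of its samples (a Gaussian density is at most 1/σ) and that all of them
lie within 40nσ of the mean. Hence the gaps of all but the last of its samples determine σ up to a
polynomial factor. With scales measured in powers of M, where M is at least of order n³, these
samples meet at most four bins (scale of the gap, position at that scale), so one bin is heavy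
(`exists_located_bin`). Changing one entry alters at most three gaps: its own and those of its old
and new predecessor (`exists_gap_eq`). So the histogram of bins is stable, and nonempty bins can be
released by independent coins whose bias climbs from 0 at count zero to 1 at a threshold T of order
log(1/δ)/ε (`releaseProb_succ`, `indist_releaseLaw`). A heavy component needs only O(T) samples, up
to logarithms, so this stage costs about KT, that is k log(1/δ)/(αε).

Selecting. Inside the released bins the parameters are put on a grid. A grid Gaussian of slightly
inflated variance dominates the true one pointwise up to a factor 1 - O(α), so components can be
rounded one by one (`exists_cover`). The cover has (polynomial)^k elements, and its logarithm is
linear in k up to logarithms. The exponential mechanism with the Yatracos minimum distance loss then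
needs about log N/α² + log N/(αε) samples for N hypotheses (`exists_selector`).

An entry belongs to only one part, so the two privacy budgets do not add (`exists_learner`). For δ
near 1, where log(1/δ) degenerates, it is enough to run a fixed learner with probability δ and
ignore the data otherwise (`exists_isDP_mixture`). -/

theorem density_nonneg (D : GMM k) (x : ℝ) : 0 ≤ D.density x :=
  Finset.sum_nonneg fun i _ => mul_nonneg (D.weight_nonneg i) (gaussianPDFReal_nonneg _ _ _)

theorem measurable_density (D : GMM k) : Measurable D.density := by
  unfold density
  exact Finset.measurable_sum _ fun i _ => (measurable_gaussianPDFReal _ _).const_mul _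

theorem integrable_density (D : GMM k) : Integrable D.density := by
  unfold density
  exact integrable_finsetSum _ fun i _ => (integrable_gaussianPDFReal _ _).const_mul _

theorem integral_density (D : GMM k) : ∫ x, D.density x = 1 := by
  unfold density
  rw [integral_finsetSum _ fun i _ => (integrable_gaussianPDFReal _ _).const_mul _]
  simp_rw [integral_const_mul, fun i => integral_gaussianPDFReal_eq_one (D.mean i)
    (D.var_pos i).ne', mul_one]
  exact D.weight_sum

theorem law_real_eq (D : GMM k) {s : Set ℝ} (hs : MeasurableSet s) :
    D.law.real s = ∫ x in s, D.density x := by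
  rw [measureReal_def, law_eq_withDensity, withDensity_apply _ hs,
    ← ofReal_integral_eq_lintegral_ofReal D.integrable_density.integrableOn
      (Filter.Eventually.of_forall D.density_nonneg),
    ENNReal.toReal_ofReal (integral_nonneg D.density_nonneg)]

theorem tvDist_comm (D D' : GMM k) : tvDist D D' = tvDist D' D := by
  simp only [tvDist, abs_sub_comm]

theorem tvDist_triangle (D₁ D₂ D₃ : GMM k) : tvDist D₁ D₃ ≤ tvDist D₁ D₂ + tvDist D₂ D₃ := by
  have h₁₂ := (D₁.integrable_density.sub D₂.integrable_density).abs
  have h₂₃ := (D₂.integrable_density.sub D₃.integrable_density).abs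
  unfold tvDist
  rw [← mul_add]
  refine mul_le_mul_of_nonneg_left ?_ (by norm_num)
  refine le_trans (integral_mono (D₁.integrable_density.sub D₃.integrable_density).abs
    (h₁₂.add h₂₃) fun x => ?_) (integral_add h₁₂ h₂₃).le
  exact abs_sub_le _ _ _

/-- The set where the first density exceeds the second. -/
def scheffe (D D' : GMM k) : Set ℝ := {x | D'.density x < D.density x}

theorem measurableSet_scheffe (D D' : GMM k) : MeasurableSet (scheffe D D') :=
  measurableSet_lt D'.measurable_density D.measurable_density

/-- Both densities integrate to one, so the positive and negative parts of the difference have equal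
mass, and half the L¹ norm is the mass of either. -/
theorem tvDist_eq_setIntegral (D D' : GMM k) :
    tvDist D D' = ∫ x in scheffe D D', (D.density x - D'.density x) := by
  have hs := measurableSet_scheffe D D'
  have hi := D.integrable_density.sub D'.integrable_density
  have h0 : ∫ x, (D.density x - D'.density x) = 0 := by
    rw [integral_sub D.integrable_density D'.integrable_density, integral_density,
      integral_density, sub_self]
  have h1 := integral_add_compl hs hi
  have h2 := integral_add_compl hs hi.abs
  have h3 : ∫ x in scheffe D D', |D.density x - D'.density x|
      = ∫ x in scheffe D D', (D.density x - D'.density x) :=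
    setIntegral_congr_fun hs fun x hx => abs_of_pos (sub_pos.2 hx)
  have h4 : ∫ x in (scheffe D D')ᶜ, |D.density x - D'.density x|
      = - ∫ x in (scheffe D D')ᶜ, (D.density x - D'.density x) := by
    rw [← integral_neg]
    exact setIntegral_congr_fun hs.compl fun x hx =>
      abs_of_nonpos (sub_nonpos.2 (not_lt.1 hx))
  simp only [Pi.sub_apply] at h1 h2
  rw [tvDist]
  linarith

theorem tvDist_eq_law_sub (D D' : GMM k) :
    tvDist D D' = D.law.real (scheffe D D') - D'.law.real (scheffe D D') := by
  have hs := measurableSet_scheffe D D'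
  rw [tvDist_eq_setIntegral, integral_sub D.integrable_density.integrableOn
    D'.integrable_density.integrableOn, law_real_eq _ hs, law_real_eq _ hs]

/-- The difference of the densities is positive exactly on the Scheffé set, so no other set collects
more mass. -/
theorem law_sub_le_tvDist (D D' : GMM k) {s : Set ℝ} (hs : MeasurableSet s) :
    D.law.real s - D'.law.real s ≤ tvDist D D' := by
  have hw := measurableSet_scheffe D D'
  have hi := D.integrable_density.sub D'.integrable_density
  rw [law_real_eq _ hs, law_real_eq _ hs, ← integral_sub D.integrable_density.integrableOn
    D'.integrable_density.integrableOn, tvDist_eq_setIntegral, ← integral_indicator hs,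
    ← integral_indicator hw]
  refine integral_mono (hi.indicator hs) (hi.indicator hw) fun x => ?_
  by_cases hx : x ∈ scheffe D D'
  · rw [Set.indicator_of_mem hx]
    by_cases hxs : x ∈ s
    · rw [Set.indicator_of_mem hxs]
    · rw [Set.indicator_of_notMem hxs]
      exact sub_nonneg.2 (le_of_lt hx)
  · rw [Set.indicator_of_notMem hx]
    exact Set.indicator_apply_nonpos fun _ => sub_nonpos.2 (not_lt.1 hx)

theorem abs_law_sub_le_tvDist (D D' : GMM k) {s : Set ℝ} (hs : MeasurableSet s) :
    |D.law.real s - D'.law.real s| ≤ tvDist D D' := by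
  rw [abs_le]
  have h1 := law_sub_le_tvDist D D' hs
  have h2 := law_sub_le_tvDist D' D hs
  rw [tvDist_comm] at h2
  constructor <;> linarith

/-- A mixture whose components almost dominate those of another mixture is close to it. -/
theorem tvDist_le_of_dominated (D D' : GMM k) {ρ : ℝ} (hρ : 0 ≤ ρ)
    (h : ∀ i, 0 < D'.weight i → ∀ x, (1 - ρ) * gaussianPDFReal (D.mean i) (D.var i) x
      ≤ gaussianPDFReal (D'.mean i) (D'.var i) x) :
    tvDist D D' ≤ ∑ i, max (D.weight i - D'.weight i) 0 + ρ := by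
  -- With weights w, w' and component densities f, f', domination gives w f - w' f' ≤ (w - (1 - ρ)
  -- w') f, and `c i` bounds that coefficient. Where w' = 0 no domination is needed.
  set c : Fin k → ℝ := fun i => max (D.weight i - D'.weight i) 0 + ρ * D'.weight i with hc
  have hc0 : ∀ i, 0 ≤ c i := fun i =>
    add_nonneg (le_max_right _ _) (mul_nonneg hρ (D'.weight_nonneg i))
  have h_int : Integrable fun x => ∑ i, c i * gaussianPDFReal (D.mean i) (D.var i) x :=
    integrable_finsetSum _ fun i _ => (integrable_gaussianPDFReal _ _).const_mul _
  have hnn : ∀ x, 0 ≤ ∑ i, c i * gaussianPDFReal (D.mean i) (D.var i) x := fun x =>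
    Finset.sum_nonneg fun i _ => mul_nonneg (hc0 i) (gaussianPDFReal_nonneg _ _ _)
  have hpt : ∀ x, D.density x - D'.density x
      ≤ ∑ i, c i * gaussianPDFReal (D.mean i) (D.var i) x := by
    intro x
    rw [density, density, ← Finset.sum_sub_distrib]
    refine Finset.sum_le_sum fun i _ => ?_
    have hf := gaussianPDFReal_nonneg (D.mean i) (D.var i) x
    have hm := mul_le_mul_of_nonneg_right (le_max_left (D.weight i - D'.weight i) 0) hf
    rcases (D'.weight_nonneg i).eq_or_lt with h0 | h0
    · simp only [hc, ← h0] at hm ⊢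
      linarith
    · have := mul_le_mul_of_nonneg_left (h i h0 x) h0.le
      simp only [hc]
      nlinarith
  rw [tvDist_eq_setIntegral]
  have hi := D.integrable_density.sub D'.integrable_density
  calc ∫ x in scheffe D D', (D.density x - D'.density x)
      ≤ ∫ x in scheffe D D', ∑ i, c i * gaussianPDFReal (D.mean i) (D.var i) x :=
        integral_mono hi.integrableOn h_int.integrableOn hpt
    _ ≤ ∫ x, ∑ i, c i * gaussianPDFReal (D.mean i) (D.var i) x :=
        setIntegral_le_integral h_int (Filter.Eventually.of_forall hnn)
    _ = ∑ i, c i := by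
        rw [integral_finsetSum _ fun i _ => (integrable_gaussianPDFReal _ _).const_mul _]
        simp_rw [integral_const_mul, fun i => integral_gaussianPDFReal_eq_one (D.mean i)
          (D.var_pos i).ne', mul_one]
    _ = _ := by
        rw [hc, Finset.sum_add_distrib, ← Finset.mul_sum, D'.weight_sum, mul_one]

theorem measurable_params :
    Measurable fun D : GMM k => (D.weight, D.mean, D.var) :=
  comap_measurable _

theorem measurable_tvDist (D' : GMM k) : Measurable fun D : GMM k => tvDist D D' := by
  have hp := measurable_params (k := k)
  have hw : ∀ i, Measurable fun D : GMM k => D.weight i := fun i =>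
    (measurable_pi_apply i).comp hp.fst
  have hm : ∀ i, Measurable fun D : GMM k => D.mean i := fun i =>
    (measurable_pi_apply i).comp hp.snd.fst
  have hv : ∀ i, Measurable fun D : GMM k => D.var i := fun i =>
    (measurable_pi_apply i).comp hp.snd.snd
  have hd : Measurable fun p : GMM k × ℝ => p.1.density p.2 := by
    unfold density gaussianPDFReal
    refine Finset.measurable_sum _ fun i _ => ?_
    have h1 : Measurable fun p : GMM k × ℝ => p.1.weight i := (hw i).comp measurable_fst
    have h2 : Measurable fun p : GMM k × ℝ => p.1.mean i := (hm i).comp measurable_fst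
    have h3 : Measurable fun p : GMM k × ℝ => ((p.1.var i : ℝ≥0) : ℝ) :=
      ((hv i).comp measurable_fst).coe_nnreal_real
    have h4 : Measurable fun p : GMM k × ℝ => p.2 := measurable_snd
    exact h1.mul (((h3.const_mul _).sqrt.inv).mul
      ((((h4.sub h2).pow_const 2).neg.div (h3.const_mul 2)).exp))
  have hd' : StronglyMeasurable fun p : GMM k × ℝ => |p.1.density p.2 - D'.density p.2| :=
    (_root_.continuous_abs.measurable.comp
      (hd.sub (D'.measurable_density.comp measurable_snd))).stronglyMeasurable
  exact hd'.integral_prod_right'.measurable.const_mul _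

end GMM

/-- Widening the variance by a factor of about 1 + η lets the tails absorb a shift of the mean by η
standard deviations. What remains is a loss of relative order η in the normalization and in the
exponent. -/
theorem gaussianPDFReal_dominated {μ μ' η : ℝ} {v v' : ℝ≥0} (hv : 0 < v) (hη : 0 < η)
    (h1 : (1 + η) * v ≤ v') (h2 : (v' : ℝ) ≤ (1 + 2 * η) * v) (hμ : (μ - μ') ^ 2 ≤ η ^ 2 * v)
    (x : ℝ) : (1 - 2 * η) * gaussianPDFReal μ v x ≤ gaussianPDFReal μ' v' x := by
  have hv0 : (0 : ℝ) < v := hv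
  have hv0' : (0 : ℝ) < v' := lt_of_lt_of_le (by positivity) h1
  unfold gaussianPDFReal
  set E := Real.exp (-(x - μ) ^ 2 / (2 * v)) with hE
  have hE0 : 0 < E := Real.exp_pos _
  have hexp : (1 - η / 2) * E ≤ Real.exp (-(x - μ') ^ 2 / (2 * v')) := by
    have h3 : (1 - η / 2) ≤ Real.exp (-(η / 2)) := by
      have := Real.add_one_le_exp (-(η / 2)); linarith
    refine (mul_le_mul_of_nonneg_right h3 hE0.le).trans ?_
    rw [hE, ← Real.exp_add]
    refine Real.exp_le_exp.2 ?_
    -- The inequality (s + t)² ≤ (1 + η) s² + (1 + 1/η) t² with t = μ - μ', proved after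
    -- multiplication by η.
    have h4 : (x - μ') ^ 2 ≤ (1 + η) * (x - μ) ^ 2 + (1 + η) * η * v := by
      have h5 : η * (x - μ') ^ 2 ≤ η * ((1 + η) * (x - μ) ^ 2 + (1 + η) * η * v) := by
        nlinarith [sq_nonneg (η * (x - μ) - (μ - μ')), mul_le_mul_of_nonneg_left hμ
          (by linarith : 0 ≤ 1 + η)]
      exact le_of_mul_le_mul_left h5 hη
    have h6 : (x - μ') ^ 2 / (2 * v') ≤ (x - μ) ^ 2 / (2 * v) + η / 2 := by
      rw [div_le_iff₀ (by positivity)]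
      have h7 : ((x - μ) ^ 2 / (2 * v) + η / 2) * (2 * ((1 + η) * v))
          = (1 + η) * (x - μ) ^ 2 + (1 + η) * η * v := by field_simp
      have h8 : 0 ≤ (x - μ) ^ 2 / (2 * v) + η / 2 := by positivity
      nlinarith [mul_le_mul_of_nonneg_left h1 h8]
    rw [neg_div, neg_div]
    linarith
  have hsq : (1 - η) * (√(2 * Real.pi * v))⁻¹ ≤ (√(2 * Real.pi * v'))⁻¹ := by
    have hpi := Real.pi_pos
    have hs : √(2 * Real.pi * v') ≤ (1 + η) * √(2 * Real.pi * v) := by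
      rw [Real.sqrt_le_left (by positivity), mul_pow, Real.sq_sqrt (by positivity)]
      have : (v' : ℝ) ≤ (1 + η) ^ 2 * v := by nlinarith [sq_nonneg η]
      nlinarith [mul_le_mul_of_nonneg_left this (by positivity : 0 ≤ 2 * Real.pi)]
    have ha : 0 < √(2 * Real.pi * v) := by positivity
    have hb : 0 < √(2 * Real.pi * v') := by positivity
    rw [← div_eq_mul_inv, ← one_div, div_le_div_iff₀ ha hb]
    rcases le_or_gt 1 η with h | h
    · nlinarith
    · nlinarith [mul_le_mul_of_nonneg_left hs (by linarith : 0 ≤ 1 - η)]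
  have hI : 0 < (√(2 * Real.pi * v))⁻¹ := by have := Real.pi_pos; positivity
  have hI' : 0 < (√(2 * Real.pi * v'))⁻¹ := by have := Real.pi_pos; positivity
  rcases le_or_gt 1 (2 * η) with h | h
  · exact (mul_nonpos_of_nonpos_of_nonneg (by linarith) (by positivity)).trans (by positivity)
  · calc (1 - 2 * η) * ((√(2 * Real.pi * v))⁻¹ * E)
        ≤ ((1 - η) * (1 - η / 2)) * ((√(2 * Real.pi * v))⁻¹ * E) :=
          mul_le_mul_of_nonneg_right (by nlinarith) (by positivity)
      _ = ((1 - η) * (√(2 * Real.pi * v))⁻¹) * ((1 - η / 2) * E) := by ring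
      _ ≤ _ := mul_le_mul hsq hexp (mul_nonneg (by linarith) hE0.le) hI'.le

/-! ### Finite covers by mixtures on a grid -/

/-- The pairs (mean, variance) that are located, up to powers of `M`, by the bin `b`: the standard
deviation is about `M ^ b.1` and the mean is about `b.2 * M ^ (b.1 + 4)`. -/
def Located (M : ℕ) (b : ℤ × ℤ) (μ : ℝ) (v : ℝ≥0) : Prop :=
  ((M : ℝ) ^ (b.1 - 1)) ^ 2 ≤ v ∧ (v : ℝ) ≤ ((M : ℝ) ^ (b.1 + 2)) ^ 2 ∧
    |μ - b.2 * (M : ℝ) ^ (b.1 + 4)| ≤ 2 * (M : ℝ) ^ (b.1 + 4)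

/-- The parameters of the components of the cover: a bin, and the grid coordinates of the mean and
of the variance inside of the bin. -/
abbrev GridIndex (M q : ℕ) (Y : Finset (ℤ × ℤ)) : Type :=
  Y × Finset.Icc (-(2 * M ^ 5 * q : ℤ)) (2 * M ^ 5 * q) ×
    Finset.Icc 1 (M ^ 6 * (q + 1) + 1)

namespace GridIndex

variable {M q : ℕ} {Y : Finset (ℤ × ℤ)}

noncomputable def mean (t : GridIndex M q Y) : ℝ :=
  t.1.1.2 * (M : ℝ) ^ (t.1.1.1 + 4) + t.2.1.1 * ((M : ℝ) ^ (t.1.1.1 - 1) / q)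

noncomputable def var (t : GridIndex M q Y) : ℝ≥0 :=
  t.2.2.1 * (((M : ℝ≥0) ^ (t.1.1.1 - 1)) ^ 2 / q)

theorem var_pos (hM : 0 < M) (hq : 0 < q) (t : GridIndex M q Y) : 0 < t.var := by
  have h1 : 0 < t.2.2.1 := (Finset.mem_Icc.1 t.2.2.2).1
  have h2 : (0 : ℝ≥0) < t.2.2.1 := by exact_mod_cast h1
  have h3 : (0 : ℝ≥0) < M := by exact_mod_cast hM
  have h4 : (0 : ℝ≥0) < q := by exact_mod_cast hq
  unfold var
  positivity

theorem card_eq : Fintype.card (GridIndex M q Y)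
    = Y.card * ((4 * M ^ 5 * q + 1) * (M ^ 6 * (q + 1) + 1)) := by
  simp only [Fintype.card_prod, Fintype.card_coe, Int.card_Icc, Nat.card_Icc]
  congr 3
  have : (2 * (M : ℤ) ^ 5 * q + 1 - -(2 * (M : ℤ) ^ 5 * q)) = ((4 * M ^ 5 * q + 1 : ℕ) : ℤ) := by
    push_cast; ring
  rw [this, Int.toNat_natCast]

theorem exists_dominated (hM : 0 < M) (hq : 0 < q) {b : ℤ × ℤ} (hb : b ∈ Y) {μ : ℝ} {v : ℝ≥0}
    (h : Located M b μ v) : ∃ t : GridIndex M q Y, ∀ x,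
      (1 - 2 / q) * gaussianPDFReal μ v x ≤ gaussianPDFReal t.mean t.var x := by
  obtain ⟨h1, h2, h3⟩ := h
  have hM0 : (0 : ℝ) < M := by exact_mod_cast hM
  have hq0 : (0 : ℝ) < q := by exact_mod_cast hq
  set u : ℝ := (M : ℝ) ^ (b.1 - 1) with hu
  have hu0 : 0 < u := zpow_pos hM0 _
  have hu2 : (M : ℝ) ^ (b.1 + 2) = u * M ^ 3 := by
    rw [hu, ← zpow_natCast, ← zpow_add₀ hM0.ne']; congr 1; push_cast; ring
  have hu4 : (M : ℝ) ^ (b.1 + 4) = u * M ^ 5 := by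
    rw [hu, ← zpow_natCast, ← zpow_add₀ hM0.ne']; congr 1; push_cast; ring
  rw [hu2] at h2
  rw [hu4] at h3
  have hv0 : (0 : ℝ) < v := lt_of_lt_of_le (by positivity) h1
  -- The offset of the mean in cells of width u / q. Since u is at most the standard deviation,
  -- rounding down moves the mean by at most η = 1/q standard deviations.
  set m : ℝ := (μ - b.2 * (u * M ^ 5)) * q / u with hm
  have hmabs : |m| ≤ 2 * M ^ 5 * q := by
    rw [hm, abs_div, abs_mul, abs_of_pos hu0, abs_of_pos hq0, div_le_iff₀ hu0]
    nlinarith [mul_le_mul_of_nonneg_right h3 hq0.le]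
  have hr : ⌊m⌋ ∈ Finset.Icc (-(2 * M ^ 5 * q : ℤ)) (2 * M ^ 5 * q) := by
    rw [abs_le] at hmabs
    rw [Finset.mem_Icc]
    constructor
    · rw [Int.le_floor]; push_cast; exact hmabs.1
    · have : ((⌊m⌋ : ℤ) : ℝ) ≤ ((2 * M ^ 5 * q : ℤ) : ℝ) := by
        push_cast; exact (Int.floor_le m).trans hmabs.2
      exact_mod_cast this
  -- The inflated variance (1 + 1/q) v in units of u² / q. Rounding up adds at most u² / q ≤ v / q,
  -- so the grid variance lies between (1 + η) v and (1 + 2η) v with η = 1/q.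
  set y : ℝ := v * (q + 1) / u ^ 2 with hy
  have hy0 : 0 < y := by positivity
  have hyle : y ≤ M ^ 6 * (q + 1) := by
    rw [hy, div_le_iff₀ (by positivity)]
    nlinarith [mul_le_mul_of_nonneg_right h2 (by positivity : (0 : ℝ) ≤ q + 1)]
  have hs : ⌈y⌉₊ ∈ Finset.Icc 1 (M ^ 6 * (q + 1) + 1) := by
    rw [Finset.mem_Icc]
    refine ⟨Nat.ceil_pos.2 hy0, (Nat.ceil_le.2 ?_).trans (Nat.le_succ _)⟩
    push_cast; exact hyle
  refine ⟨⟨⟨b, hb⟩, ⟨⌊m⌋, hr⟩, ⟨⌈y⌉₊, hs⟩⟩, fun x => ?_⟩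
  have hvar : ((GridIndex.var (M := M) (q := q) (Y := Y)
      ⟨⟨b, hb⟩, ⟨⌊m⌋, hr⟩, ⟨⌈y⌉₊, hs⟩⟩ : ℝ≥0) : ℝ) = ⌈y⌉₊ * (u ^ 2 / q) := by
    simp [GridIndex.var, hu]
  have hmean : GridIndex.mean (M := M) (q := q) (Y := Y)
      ⟨⟨b, hb⟩, ⟨⌊m⌋, hr⟩, ⟨⌈y⌉₊, hs⟩⟩ = b.2 * (u * M ^ 5) + ⌊m⌋ * (u / q) := by
    simp only [GridIndex.mean, hu4, hu]
  have hyv : y * (u ^ 2 / q) = (1 + 1 / q) * v := by rw [hy]; field_simp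
  have hmv : m * (u / q) = μ - b.2 * (u * M ^ 5) := by rw [hm]; field_simp
  have huq : 0 < u / q := by positivity
  have huq2 : 0 < u ^ 2 / q := by positivity
  rw [show (2 : ℝ) / q = 2 * (1 / q) by ring]
  refine gaussianPDFReal_dominated hv0 (by positivity) ?_ ?_ ?_ x
  · rw [hvar, ← hyv]
    exact mul_le_mul_of_nonneg_right (Nat.le_ceil y) huq2.le
  · rw [hvar]
    have h5 := mul_le_mul_of_nonneg_right (Nat.ceil_lt_add_one hy0.le).le huq2.le
    have h6 : u ^ 2 / q ≤ 1 / q * v := by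
      rw [div_le_iff₀ hq0]; field_simp; exact h1
    linarith
  · rw [hmean]
    have h5 : μ - (b.2 * (u * M ^ 5) + ⌊m⌋ * (u / q)) = (m - ⌊m⌋) * (u / q) := by
      rw [sub_mul, hmv]; ring
    rw [h5, mul_pow]
    have h6 : (m - ⌊m⌋) ^ 2 ≤ 1 := by
      have := Int.floor_le m
      have := Int.lt_floor_add_one m
      nlinarith
    calc (m - ⌊m⌋) ^ 2 * (u / q) ^ 2 ≤ 1 * (u / q) ^ 2 :=
          mul_le_mul_of_nonneg_right h6 (by positivity)
      _ = (1 / q) ^ 2 * u ^ 2 := by ring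
      _ ≤ _ := mul_le_mul_of_nonneg_left h1 (by positivity)

end GridIndex

/-- Weights that sum to one can be rounded to multiples of `1 / K`, such that no weight decreases by
more than `1 / K`, and the light ones vanish. -/
theorem exists_rounding {k K : ℕ} (hk : 0 < k) (hK : k ≤ K) (w : Fin k → ℝ) (hw : ∀ i, 0 ≤ w i)
    (hsum : ∑ i, w i = 1) : ∃ a : Fin k → ℕ, ∑ i, a i = K ∧
      ∀ i, (w i - a i / K ≤ 1 / K) ∧ (0 < a i → 1 / K ≤ w i) := by
  have hK0 : (0 : ℝ) < K := by exact_mod_cast hk.trans_le hK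
  have hk0 : (0 : ℝ) < k := by exact_mod_cast hk
  -- A component of weight at least 1/k ≥ 1/K receives all the mass that the others lose by rounding
  -- down; its own weight does not decrease.
  obtain ⟨i₀, -, hi₀⟩ : ∃ i ∈ Finset.univ, (1 : ℝ) / k ≤ w i := by
    refine Finset.exists_le_of_sum_le ⟨⟨0, hk⟩, Finset.mem_univ _⟩ ?_
    simp [hsum, hk0.ne']
  have hi₀' : 1 / (K : ℝ) ≤ w i₀ := (one_div_le_one_div_of_le hk0 (by exact_mod_cast hK)).trans hi₀
  set f : Fin k → ℕ := fun i => ⌊K * w i⌋₊ with hf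
  have hfle : ∀ i, (f i : ℝ) ≤ K * w i := fun i => Nat.floor_le (mul_nonneg hK0.le (hw i))
  set s : ℕ := ∑ i ∈ Finset.univ.erase i₀, f i with hs
  have hsle : (s : ℝ) ≤ K * (1 - w i₀) := by
    rw [hs, Nat.cast_sum, ← hsum, ← Finset.add_sum_erase _ _ (Finset.mem_univ i₀),
      add_sub_cancel_left, Finset.mul_sum]
    exact Finset.sum_le_sum fun i _ => hfle i
  have hsK : s ≤ K := by
    have : (s : ℝ) ≤ K := hsle.trans (by nlinarith [hw i₀])
    exact_mod_cast this
  refine ⟨fun i => if i = i₀ then K - s else f i, ?_, fun i => ?_⟩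
  · rw [← Finset.add_sum_erase _ _ (Finset.mem_univ i₀), if_pos rfl]
    rw [Finset.sum_congr rfl fun i hi => if_neg (Finset.ne_of_mem_erase hi), ← hs]
    omega
  · by_cases hi : i = i₀
    · subst hi
      refine ⟨?_, fun _ => hi₀'⟩
      simp only [if_true]
      rw [Nat.cast_sub hsK, sub_div, div_self hK0.ne']
      have : (s : ℝ) / K ≤ 1 - w i := by rw [div_le_iff₀ hK0]; linarith
      have : 0 < 1 / (K : ℝ) := by positivity
      linarith
    · simp only [if_neg hi]
      constructor
      · rw [sub_le_iff_le_add, ← add_div, le_div_iff₀ hK0]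
        have := Nat.lt_floor_add_one (K * w i)
        rw [mul_comm]; linarith
      · intro h
        have : 1 ≤ K * w i := (by exact_mod_cast h : (1 : ℝ) ≤ f i).trans (hfle i)
        rw [div_le_iff₀ hK0]; linarith

/-- Finite cover of the mixtures all of whose heavy components are located by the bins in `Y`. -/
theorem exists_cover {k K M q : ℕ} (hk : 0 < k) (hK : k ≤ K) (hM : 0 < M) (hq : 0 < q)
    {Y : Finset (ℤ × ℤ)} (hY : Y.Nonempty) :
    ∃ (ι : Type) (_ : Fintype ι) (_ : Nonempty ι) (h : ι → GMM k),
      Fintype.card ι ≤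
        (Y.card * ((4 * M ^ 5 * q + 1) * (M ^ 6 * (q + 1) + 1)) * (K + 1)) ^ k ∧
      ∀ D : GMM k, (∀ i, 1 / (K : ℝ) ≤ D.weight i → ∃ b ∈ Y, Located M b (D.mean i) (D.var i)) →
        ∃ i, GMM.tvDist (h i) D ≤ k / K + 2 / q := by
  classical
  have hK0 : (0 : ℝ) < K := by exact_mod_cast hk.trans_le hK
  obtain ⟨b₀, hb₀⟩ := hY
  -- A filler for the components whose rounded weight is zero; its location is irrelevant.
  let t₀ : GridIndex M q Y := ⟨⟨b₀, hb₀⟩, ⟨0, by simp; positivity⟩, ⟨1, by simp⟩⟩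
  let ι : Type := {f : Fin k → GridIndex M q Y × Fin (K + 1) // ∑ i, ((f i).2 : ℕ) = K}
  let h : ι → GMM k := fun f =>
    { weight := fun i => ((f.1 i).2 : ℕ) / K
      mean := fun i => (f.1 i).1.mean
      var := fun i => (f.1 i).1.var
      weight_nonneg := fun i => by positivity
      weight_sum := by
        rw [← Finset.sum_div, ← Nat.cast_sum, f.2, div_self hK0.ne']
      var_pos := fun i => (f.1 i).1.var_pos hM hq }
  have key : ∀ (t : Fin k → GridIndex M q Y) (a : Fin k → ℕ), ∑ i, a i = K →
      ∃ f : ι, ∀ i, (f.1 i).1 = t i ∧ ((f.1 i).2 : ℕ) = a i := by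
    intro t a ha
    have hle : ∀ i, a i < K + 1 := fun i =>
      Nat.lt_succ_of_le (ha ▸ Finset.single_le_sum (fun _ _ => Nat.zero_le _) (Finset.mem_univ i))
    exact ⟨⟨fun i => (t i, ⟨a i, hle i⟩), ha⟩, fun i => ⟨rfl, rfl⟩⟩
  have hne : Nonempty ι := by
    obtain ⟨f, -⟩ := key (fun _ => t₀) (Pi.single ⟨0, hk⟩ K) (by simp)
    exact ⟨f⟩
  refine ⟨ι, inferInstance, hne, h, ?_, fun D hD => ?_⟩
  · refine (Fintype.card_subtype_le _).trans ?_
    rw [Fintype.card_fun, Fintype.card_prod, GridIndex.card_eq, Fintype.card_fin, Fintype.card_fin]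
  · obtain ⟨a, ha, haw⟩ := exists_rounding hk hK D.weight D.weight_nonneg D.weight_sum
    have ht : ∀ i, ∃ t : GridIndex M q Y, 1 / (K : ℝ) ≤ D.weight i → ∀ x,
        (1 - 2 / q) * gaussianPDFReal (D.mean i) (D.var i) x ≤ gaussianPDFReal t.mean t.var x := by
      intro i
      by_cases hi : 1 / (K : ℝ) ≤ D.weight i
      · obtain ⟨b, hb, hl⟩ := hD i hi
        obtain ⟨t, ht⟩ := GridIndex.exists_dominated hM hq hb hl
        exact ⟨t, fun _ => ht⟩
      · exact ⟨t₀, fun h => absurd h hi⟩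
    choose t ht using ht
    obtain ⟨f, hf⟩ := key t a ha
    refine ⟨f, ?_⟩
    rw [GMM.tvDist_comm]
    refine (GMM.tvDist_le_of_dominated D (h f) (ρ := 2 / q) (by positivity)
      fun i hi x => ?_).trans ?_
    -- A positive rounded weight forces the original weight to be at least 1/K, so the component is
    -- located and was given a dominating grid point.
    · have hai : 0 < a i := by
        simp only [h, (hf i).2] at hi
        rcases Nat.eq_zero_or_pos (a i) with h0 | h0
        · simp [h0] at hi
        · exact h0
      have := ht i ((haw i).2 hai) x
      simpa only [h, (hf i).1] using this
    · gcongr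
      calc ∑ i, max (D.weight i - (h f).weight i) 0 ≤ ∑ _i : Fin k, 1 / (K : ℝ) := by
            refine Finset.sum_le_sum fun i _ => max_le ?_ (by positivity)
            simpa only [h, (hf i).2] using (haw i).1
        _ = k / K := by simp [div_eq_mul_inv]

/-! ### The exponential mechanism -/

section ExponentialMechanism

variable {ι X O : Type*} [Fintype ι] [Nonempty ι] [MeasurableSpace X] [MeasurableSpace O] {n : ℕ}

/-- The probabilities of the exponential mechanism for the loss `u` at privacy level `ε`. -/
noncomputable def gibbs (ε : ℝ) (u : ι → ℝ) (i : ι) : ℝ :=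
  Real.exp (-(ε / 2 * u i)) / ∑ j, Real.exp (-(ε / 2 * u j))

theorem gibbs_denom_pos (ε : ℝ) (u : ι → ℝ) : 0 < ∑ j, Real.exp (-(ε / 2 * u j)) :=
  Finset.sum_pos (fun _ _ => Real.exp_pos _) Finset.univ_nonempty

theorem gibbs_nonneg (ε : ℝ) (u : ι → ℝ) (i : ι) : 0 ≤ gibbs ε u i :=
  div_nonneg (Real.exp_pos _).le (gibbs_denom_pos ε u).le

theorem sum_gibbs (ε : ℝ) (u : ι → ℝ) : ∑ i, gibbs ε u i = 1 := by
  unfold gibbs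
  rw [← Finset.sum_div, div_self (gibbs_denom_pos ε u).ne']

/-- The numerator and the normalizing sum each change by a factor of at most exp(ε/2). -/
theorem gibbs_le_exp_mul {ε : ℝ} (hε : 0 ≤ ε) {u u' : ι → ℝ} (h : ∀ i, |u i - u' i| ≤ 1) (i : ι) :
    gibbs ε u' i ≤ Real.exp ε * gibbs ε u i := by
  have key : ∀ {a b : ℝ}, |a - b| ≤ 1 →
      Real.exp (-(ε / 2 * b)) ≤ Real.exp (ε / 2) * Real.exp (-(ε / 2 * a)) := by
    intro a b hab
    rw [← Real.exp_add]
    refine Real.exp_le_exp.2 ?_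
    nlinarith [(abs_le.1 hab).2]
  unfold gibbs
  rw [← mul_div_assoc, div_le_div_iff₀ (gibbs_denom_pos ε u') (gibbs_denom_pos ε u)]
  have h1 := key (h i)
  have h2 : ∑ j, Real.exp (-(ε / 2 * u j))
      ≤ Real.exp (ε / 2) * ∑ j, Real.exp (-(ε / 2 * u' j)) := by
    rw [Finset.mul_sum]
    exact Finset.sum_le_sum fun j _ => key (by rw [abs_sub_comm]; exact h j)
  have h3 : Real.exp ε = Real.exp (ε / 2) * Real.exp (ε / 2) := by
    rw [← Real.exp_add]; congr 1; ring
  rw [h3]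
  calc _ ≤ (Real.exp (ε / 2) * Real.exp (-(ε / 2 * u i))) *
        (Real.exp (ε / 2) * ∑ j, Real.exp (-(ε / 2 * u' j))) :=
        mul_le_mul h1 h2 (gibbs_denom_pos ε u).le (by positivity)
    _ = _ := by ring

/-- The single term of `i₀` in the denominator already exceeds the numerator by the factor
exp(εs/2). -/
theorem gibbs_le_of_add_le {ε : ℝ} (hε : 0 ≤ ε) {u : ι → ℝ} {i i₀ : ι} {s : ℝ}
    (h : u i₀ + s ≤ u i) : gibbs ε u i ≤ Real.exp (-(ε * s / 2)) := by
  unfold gibbs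
  rw [div_le_iff₀ (gibbs_denom_pos ε u)]
  calc Real.exp (-(ε / 2 * u i)) ≤ Real.exp (-(ε * s / 2)) * Real.exp (-(ε / 2 * u i₀)) := by
        rw [← Real.exp_add]
        refine Real.exp_le_exp.2 ?_
        nlinarith
    _ ≤ _ := by
        refine mul_le_mul_of_nonneg_left ?_ (Real.exp_pos _).le
        exact Finset.single_le_sum (f := fun j => Real.exp (-(ε / 2 * u j)))
          (fun _ _ => (Real.exp_pos _).le) (Finset.mem_univ i₀)

/-- The exponential mechanism with losses `u` and outputs `h`. -/
noncomputable def expMechanism (ε : ℝ) (u : X → ι → ℝ) (hu : ∀ i, Measurable fun x => u x i)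
    (h : ι → O) : Kernel X O where
  toFun x := ∑ i, ENNReal.ofReal (gibbs ε (u x) i) • Measure.dirac (h i)
  measurable' := by
    refine Measure.measurable_of_measurable_coe _ fun S hS => ?_
    simp only [Measure.finsetSum_apply, Measure.smul_apply, smul_eq_mul]
    refine Finset.measurable_sum _ fun i _ => Measurable.mul_const ?_ _
    refine Measurable.ennreal_ofReal ?_
    unfold gibbs
    exact (((hu i).const_mul _).neg.exp).div
      (Finset.measurable_sum _ fun j _ => ((hu j).const_mul _).neg.exp)

theorem expMechanism_apply {ι X O : Type*} [Fintype ι] [MeasurableSpace X] [MeasurableSpace O]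
    (ε : ℝ) (u : X → ι → ℝ) (hu : ∀ i, Measurable fun x => u x i)
    (h : ι → O) (x : X) (S : Set O) :
    expMechanism ε u hu h x S
      = ∑ i, ENNReal.ofReal (gibbs ε (u x) i) * Measure.dirac (h i) S := by
  change (∑ i, ENNReal.ofReal (gibbs ε (u x) i) • Measure.dirac (h i)) S = _
  simp only [Measure.finsetSum_apply, Measure.smul_apply, smul_eq_mul]

instance (ε : ℝ) (u : X → ι → ℝ) (hu : ∀ i, Measurable fun x => u x i) (h : ι → O) :
    IsMarkovKernel (expMechanism ε u hu h) := by
  refine ⟨fun x => ⟨?_⟩⟩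
  rw [expMechanism_apply]
  simp only [measure_univ, mul_one]
  rw [← ENNReal.ofReal_sum_of_nonneg fun i _ => gibbs_nonneg _ _ i, sum_gibbs, ENNReal.ofReal_one]

theorem isDP_expMechanism {ε : ℝ} (hε : 0 ≤ ε) (u : (Fin n → X) → ι → ℝ)
    (hu : ∀ i, Measurable fun x => u x i) (h : ι → O)
    (hs : ∀ x x', Neighboring x x' → ∀ i, |u x i - u x' i| ≤ 1) :
    IsDP (expMechanism ε u hu h) ε 0 := by
  intro x x' hx S _
  rw [expMechanism_apply, expMechanism_apply, ENNReal.ofReal_zero, add_zero, Finset.mul_sum]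
  refine Finset.sum_le_sum fun i _ => ?_
  rw [← mul_assoc, ← ENNReal.ofReal_mul (Real.exp_pos _).le]
  gcongr
  exact gibbs_le_exp_mul hε (hs x x' hx) i

/-- A union bound over all indices. The cardinality here is what makes the sample size depend on the
logarithm of the number of hypotheses. -/
theorem expMechanism_apply_le {ε : ℝ} (hε : 0 ≤ ε) (u : X → ι → ℝ)
    (hu : ∀ i, Measurable fun x => u x i) (h : ι → O) (x : X) {S : Set O} (hS : MeasurableSet S)
    {s : ℝ} {i₀ : ι} (hs : ∀ i, h i ∈ S → u x i₀ + s ≤ u x i) :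
    expMechanism ε u hu h x S ≤ ENNReal.ofReal (Fintype.card ι * Real.exp (-(ε * s / 2))) := by
  rw [expMechanism_apply]
  calc _ ≤ ∑ _i : ι, ENNReal.ofReal (Real.exp (-(ε * s / 2))) := by
        refine Finset.sum_le_sum fun i _ => ?_
        rw [Measure.dirac_apply' _ hS]
        by_cases hi : h i ∈ S
        · rw [Set.indicator_of_mem hi, Pi.one_apply, mul_one]
          exact ENNReal.ofReal_le_ofReal (gibbs_le_of_add_le hε (hs i hi))
        · rw [Set.indicator_of_notMem hi, mul_zero]
          exact zero_le
    _ = _ := by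
        rw [Finset.sum_const, Finset.card_univ, nsmul_eq_mul,
          ENNReal.ofReal_mul (Nat.cast_nonneg _), ENNReal.ofReal_natCast]

end ExponentialMechanism

/-! ### Empirical frequencies -/

section Frequencies

variable {X : Type*} [MeasurableSpace X] {n : ℕ}

/-- The number of entries of the dataset `x` in `S`, as a real number. -/
noncomputable def empCount (x : Fin n → X) (S : Set X) : ℝ :=
  ∑ a, S.indicator (fun _ => (1 : ℝ)) (x a)

theorem measurable_empCount {S : Set X} (hS : MeasurableSet S) :
    Measurable fun x : Fin n → X => empCount x S :=
  Finset.measurable_sum _ fun a _ =>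
    (measurable_const.indicator hS).comp (measurable_pi_apply a)

theorem abs_empCount_sub_le {X : Type*} {x x' : Fin n → X} (h : Neighboring x x') (S : Set X) :
    |empCount x S - empCount x' S| ≤ 1 := by
  obtain ⟨j, hj⟩ := h
  have h1 : empCount x S - empCount x' S
      = S.indicator (fun _ => (1 : ℝ)) (x j) - S.indicator (fun _ => (1 : ℝ)) (x' j) := by
    unfold empCount
    rw [← Finset.sum_sub_distrib]
    refine Finset.sum_eq_single j (fun b _ hb => ?_) (fun h => absurd (Finset.mem_univ _) h)
    rw [hj b hb, sub_self]
  rw [h1]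
  by_cases hx : x j ∈ S <;> by_cases hx' : x' j ∈ S <;> simp [hx, hx']

/-- Hoeffding's inequality for empirical frequencies, one-sided. -/
theorem measure_empCount_sub_ge_le (P : Measure X) [IsProbabilityMeasure P] {S : Set X}
    (hS : MeasurableSet S) {t : ℝ} (ht : 0 ≤ t) :
    (Measure.pi fun _ : Fin n => P).real {x | t ≤ empCount x S - n * P.real S}
      ≤ Real.exp (-(2 * t ^ 2 / n)) := by
  set f : X → ℝ := S.indicator (fun _ => (1 : ℝ)) with hf
  have hfm : Measurable f := measurable_const.indicator hS
  have h_int : ∀ a : Fin n, ∫ x, f (x a) ∂(Measure.pi fun _ : Fin n => P) = P.real S := by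
    intro a
    have := (measurePreserving_eval (fun _ : Fin n => P) a)
    have h1 : ∫ y, f y ∂P = P.real S := integral_indicator_one hS
    rw [← h1]
    conv_rhs => rw [← this.map_eq]
    rw [integral_map (measurable_pi_apply a).aemeasurable hfm.aestronglyMeasurable]
  have hsub : ∀ a ∈ (Finset.univ : Finset (Fin n)), HasSubgaussianMGF
      (fun x : Fin n → X => f (x a) - P.real S) ((‖(1 : ℝ) - 0‖₊ / 2) ^ 2)
      (Measure.pi fun _ : Fin n => P) := by
    intro a _
    have := hasSubgaussianMGF_of_mem_Icc (μ := Measure.pi fun _ : Fin n => P)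
      (X := fun x => f (x a)) (a := 0) (b := 1)
      (hfm.comp (measurable_pi_apply a)).aemeasurable (Filter.Eventually.of_forall fun x => by
        by_cases hx : x a ∈ S <;> simp [hf, hx])
    rwa [h_int a] at this
  have hind : iIndepFun (fun (a : Fin n) (x : Fin n → X) => f (x a) - P.real S)
      (Measure.pi fun _ : Fin n => P) :=
    iIndepFun_pi (X := fun _ y => f y - P.real S) fun _ => (hfm.sub_const _).aemeasurable
  have h := HasSubgaussianMGF.measure_sum_ge_le_of_iIndepFun hind hsub ht
  have heq : ∀ x : Fin n → X, ∑ a, (f (x a) - P.real S) = empCount x S - n * P.real S := by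
    intro x
    rw [Finset.sum_sub_distrib, Finset.sum_const, Finset.card_univ, Fintype.card_fin, nsmul_eq_mul]
    rfl
  simp only [heq] at h
  refine h.trans (le_of_eq ?_)
  congr 1
  simp only [sub_zero, Finset.sum_const, Finset.card_univ, Fintype.card_fin, nsmul_eq_mul]
  push_cast
  simp only [norm_one]
  -- For n = 0 both exponents are quotients by zero, hence zero.
  rcases Nat.eq_zero_or_pos n with h0 | h0
  · simp [h0]
  · have : (0 : ℝ) < n := by exact_mod_cast h0
    field_simp

/-- Hoeffding's inequality for empirical frequencies. -/
theorem measure_abs_empCount_sub_ge_le (P : Measure X) [IsProbabilityMeasure P] {S : Set X}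
    (hS : MeasurableSet S) {t : ℝ} (ht : 0 ≤ t) :
    (Measure.pi fun _ : Fin n => P).real {x | t ≤ |empCount x S - n * P.real S|}
      ≤ 2 * Real.exp (-(2 * t ^ 2 / n)) := by
  have hc : ∀ x : Fin n → X, empCount x Sᶜ - n * P.real Sᶜ = -(empCount x S - n * P.real S) := by
    intro x
    have h1 : empCount x S + empCount x Sᶜ = n := by
      unfold empCount
      rw [← Finset.sum_add_distrib]
      simp [Set.indicator_compl]
    rw [probReal_compl_eq_one_sub hS]
    linarith
  have h1 := measure_empCount_sub_ge_le (n := n) P hS ht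
  have h2 := measure_empCount_sub_ge_le (n := n) P hS.compl ht
  simp only [hc] at h2
  have : {x : Fin n → X | t ≤ |empCount x S - n * P.real S|}
      = {x | t ≤ empCount x S - n * P.real S} ∪ {x | t ≤ -(empCount x S - n * P.real S)} := by
    ext x; simp [le_abs]
  rw [this]
  refine (measureReal_union_le _ _).trans ?_
  linarith

end Frequencies

/-! ### Private hypothesis selection -/

section Selection

variable {ι : Type*} [Fintype ι] [Nonempty ι] {k n : ℕ}

/-- The minimum distance loss: the largest deviation, over the Yatracos class of the hypotheses,
between the expected and the observed number of samples. -/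
noncomputable def yatracosLoss (h : ι → GMM k) (x : Fin n → ℝ) (i : ι) : ℝ :=
  (Finset.univ : Finset (ι × ι)).sup' Finset.univ_nonempty fun p =>
    |n * (h i).law.real (GMM.scheffe (h p.1) (h p.2)) - empCount x (GMM.scheffe (h p.1) (h p.2))|

theorem measurable_yatracosLoss (h : ι → GMM k) (i : ι) :
    Measurable fun x : Fin n → ℝ => yatracosLoss h x i := by
  unfold yatracosLoss
  have := Finset.measurable_sup' (s := (Finset.univ : Finset (ι × ι))) Finset.univ_nonempty
    (f := fun p (x : Fin n → ℝ) => |n * (h i).law.real (GMM.scheffe (h p.1) (h p.2)) -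
      empCount x (GMM.scheffe (h p.1) (h p.2))|) fun p _ =>
      _root_.continuous_abs.measurable.comp ((measurable_empCount
        (GMM.measurableSet_scheffe _ _)).const_sub _)
  convert this using 2 with x
  rw [Finset.sup'_apply]

theorem abs_sub_le_yatracosLoss (h : ι → GMM k) (x : Fin n → ℝ) (i j l : ι) :
    |n * (h i).law.real (GMM.scheffe (h j) (h l)) - empCount x (GMM.scheffe (h j) (h l))|
      ≤ yatracosLoss h x i :=
  Finset.le_sup' (fun p : ι × ι => |n * (h i).law.real (GMM.scheffe (h p.1) (h p.2)) -
    empCount x (GMM.scheffe (h p.1) (h p.2))|) (Finset.mem_univ (j, l))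

theorem yatracosLoss_le (h : ι → GMM k) (x : Fin n → ℝ) (i : ι) {t : ℝ}
    (ht : ∀ j l, |n * (h i).law.real (GMM.scheffe (h j) (h l)) -
      empCount x (GMM.scheffe (h j) (h l))| ≤ t) : yatracosLoss h x i ≤ t :=
  Finset.sup'_le _ _ fun p _ => ht p.1 p.2

/-- The loss is measured in counts rather than frequencies, so that one entry moves it by at most 1,
the sensitivity that `isDP_expMechanism` expects. -/
theorem abs_yatracosLoss_sub_le (h : ι → GMM k) {x x' : Fin n → ℝ} (hx : Neighboring x x') (i : ι) :
    |yatracosLoss h x i - yatracosLoss h x' i| ≤ 1 := by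
  have key : ∀ {x x' : Fin n → ℝ}, Neighboring x x' →
      yatracosLoss h x i ≤ yatracosLoss h x' i + 1 := by
    intro x x' hx
    refine yatracosLoss_le h x i fun j l => ?_
    have h1 := abs_sub_le_yatracosLoss h x' i j l
    have h2 := abs_empCount_sub_le hx (GMM.scheffe (h j) (h l))
    rw [abs_le] at *
    constructor <;> linarith
  have hx' : Neighboring x' x := hx.imp fun j hj i hi => (hj i hi).symm
  rw [abs_le]
  constructor <;> linarith [key hx, key hx']

/-- A hypothesis whose loss is almost minimal is almost as good as every other hypothesis, provided
that the empirical frequencies of the Yatracos class are accurate. -/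
theorem tvDist_le_of_yatracosLoss_le (h : ι → GMM k) (D : GMM k) (x : Fin n → ℝ) (hn : 0 < n)
    {i i₀ : ι} {r s t : ℝ} (hr : GMM.tvDist (h i₀) D ≤ r)
    (ht : ∀ j l, |empCount x (GMM.scheffe (h j) (h l)) -
      n * D.law.real (GMM.scheffe (h j) (h l))| ≤ n * t)
    (hs : yatracosLoss h x i ≤ yatracosLoss h x i₀ + n * s) :
    GMM.tvDist (h i) D ≤ 3 * r + 2 * t + s := by
  have hn0 : (0 : ℝ) < n := by exact_mod_cast hn
  have h0 : yatracosLoss h x i₀ ≤ n * (r + t) := by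
    refine yatracosLoss_le h x i₀ fun j l => ?_
    have h1 := ht j l
    have h2 := (GMM.abs_law_sub_le_tvDist (h i₀) D
      (GMM.measurableSet_scheffe (h j) (h l))).trans hr
    rw [abs_le] at *
    constructor <;> nlinarith
  -- The Scheffé set of `h i` and `h i₀` is in the class and realizes their distance. Both losses
  -- control it, which gives (r + t + s) + (r + t); the triangle inequality through `h i₀` adds the
  -- last r.
  have h1 := abs_sub_le_yatracosLoss h x i i i₀
  have h2 := abs_sub_le_yatracosLoss h x i₀ i i₀
  have h3 : n * GMM.tvDist (h i) (h i₀) ≤ n * (2 * r + 2 * t + s) := by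
    rw [GMM.tvDist_eq_law_sub]
    rw [abs_le] at h1 h2
    nlinarith
  have h4 := le_of_mul_le_mul_left h3 hn0
  linarith [GMM.tvDist_triangle (h i) (h i₀) D]

/-- Private hypothesis selection from a finite list of hypotheses. -/
theorem exists_selector (h : ι → GMM k) {α ε : ℝ} (hα : 0 < α) (hε : 0 < ε) (hn : 0 < n)
    (hn1 : 20 / (α * ε) * Real.log (40 * Fintype.card ι) ≤ n)
    (hn2 : 50 / α ^ 2 * Real.log (80 * (Fintype.card ι : ℝ) ^ 2) ≤ n) :
    ∃ κ : Kernel (Fin n → ℝ) (GMM k), IsMarkovKernel κ ∧ IsDP κ ε 0 ∧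
      ∀ D : GMM k, (∃ i, GMM.tvDist (h i) D ≤ α / 10) →
        ∫⁻ x, κ x {H | α < GMM.tvDist H D} ∂(Measure.pi fun _ : Fin n => D.law) ≤ 1 / 20 := by
  have hn0 : (0 : ℝ) < n := by exact_mod_cast hn
  have hN : (0 : ℝ) < Fintype.card ι := by exact_mod_cast Fintype.card_pos
  refine ⟨expMechanism ε (yatracosLoss h) (measurable_yatracosLoss h) h, inferInstance,
    isDP_expMechanism hε.le _ _ _ fun x x' hx i => abs_yatracosLoss_sub_le h hx i, ?_⟩
  rintro D ⟨i₀, hi₀⟩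
  set κ := expMechanism ε (yatracosLoss h) (measurable_yatracosLoss (n := n) h) h with hκ
  set P := Measure.pi fun _ : Fin n => D.law with hP
  have hS : MeasurableSet {H : GMM k | α < GMM.tvDist H D} :=
    measurableSet_lt measurable_const (GMM.measurable_tvDist D)
  set W : ι × ι → Set ℝ := fun p => GMM.scheffe (h p.1) (h p.2) with hW
  have hWm : ∀ p, MeasurableSet (W p) := fun p => GMM.measurableSet_scheffe _ _
  set B : Set (Fin n → ℝ) := ⋃ p, {x | n * (α / 10) ≤ |empCount x (W p) - n * D.law.real (W p)|}
    with hB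
  have hBm : MeasurableSet B := MeasurableSet.iUnion fun p => measurableSet_le measurable_const
    (_root_.continuous_abs.measurable.comp ((measurable_empCount (hWm p)).sub_const _))
  have hPB : P B ≤ 1 / 40 := by
    calc P B ≤ ∑ p : ι × ι,
          P {x | n * (α / 10) ≤ |empCount x (W p) - n * D.law.real (W p)|} :=
          measure_iUnion_fintype_le _ _
      _ ≤ ∑ _p : ι × ι, ENNReal.ofReal (1 / (40 * (Fintype.card ι : ℝ) ^ 2)) := by
          refine Finset.sum_le_sum fun p _ => ?_
          rw [← ofReal_measureReal]
          refine ENNReal.ofReal_le_ofReal ?_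
          refine (measure_abs_empCount_sub_ge_le D.law (hWm p) (by positivity)).trans ?_
          have h1 : Real.log (80 * (Fintype.card ι : ℝ) ^ 2) ≤ 2 * (n * (α / 10)) ^ 2 / n := by
            rw [div_mul_eq_mul_div, div_le_iff₀ (by positivity)] at hn2
            rw [le_div_iff₀ hn0]
            nlinarith
          have h2 := Real.exp_le_exp.2 (neg_le_neg h1)
          rw [Real.exp_neg (Real.log _), Real.exp_log (by positivity)] at h2
          calc _ ≤ 2 * (80 * (Fintype.card ι : ℝ) ^ 2)⁻¹ := by linarith
            _ = _ := by field_simp; norm_num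
      _ = 1 / 40 := by
          rw [Finset.sum_const, Finset.card_univ, Fintype.card_prod, nsmul_eq_mul,
            ← ENNReal.ofReal_natCast, ← ENNReal.ofReal_mul (Nat.cast_nonneg _)]
          rw [show ((Fintype.card ι * Fintype.card ι : ℕ) : ℝ) *
            (1 / (40 * (Fintype.card ι : ℝ) ^ 2)) = 1 / 40 by push_cast; field_simp]
          rw [ENNReal.ofReal_div_of_pos (by norm_num)]
          simp
  have hgood : ∀ x ∉ B, κ x {H | α < GMM.tvDist H D} ≤ 1 / 40 := by
    intro x hx
    -- With r = t = s = α/10 a near-minimizer of the loss is within 6α/10 < α of `D`, so every bad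
    -- hypothesis has excess loss at least nα/10.
    refine (expMechanism_apply_le hε.le _ _ _ x hS (s := n * (α / 10)) (i₀ := i₀)
      fun i hi => ?_).trans ?_
    · by_contra! hlt
      have hx' : ∀ j l, |empCount x (GMM.scheffe (h j) (h l)) -
          n * D.law.real (GMM.scheffe (h j) (h l))| ≤ n * (α / 10) := by
        intro j l
        simp only [hB, Set.mem_iUnion, Set.mem_ofPred_eq, not_exists, not_le] at hx
        exact (hx (j, l)).le
      have := tvDist_le_of_yatracosLoss_le h D x hn hi₀ hx' hlt.le
      simp only [Set.mem_ofPred_eq] at hi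
      linarith
    · have h1 : Real.log (40 * Fintype.card ι) ≤ ε * (n * (α / 10)) / 2 := by
        rw [div_mul_eq_mul_div, div_le_iff₀ (by positivity)] at hn1
        nlinarith
      have h2 := Real.exp_le_exp.2 (neg_le_neg h1)
      rw [Real.exp_neg (Real.log _), Real.exp_log (by positivity)] at h2
      calc _ ≤ ENNReal.ofReal (1 / 40) := by
            refine ENNReal.ofReal_le_ofReal ?_
            calc _ ≤ Fintype.card ι * (40 * (Fintype.card ι : ℝ))⁻¹ :=
                  mul_le_mul_of_nonneg_left h2 hN.le
              _ = _ := by field_simp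
        _ = 1 / 40 := by rw [ENNReal.ofReal_div_of_pos (by norm_num)]; simp
  calc ∫⁻ x, κ x {H | α < GMM.tvDist H D} ∂P
      ≤ ∫⁻ x, (B.indicator 1 x + 1 / 40) ∂P := by
        refine lintegral_mono fun x => ?_
        by_cases hx : x ∈ B
        · rw [Set.indicator_of_mem hx]
          exact prob_le_one.trans le_self_add
        · exact (hgood x hx).trans le_add_self
    _ = P B + 1 / 40 := by
        rw [lintegral_add_right _ measurable_const, lintegral_indicator_one hBm, lintegral_const,
          measure_univ, mul_one]
    _ ≤ 1 / 40 + 1 / 40 := by gcongr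
    _ = 1 / 20 := by
        rw [← ENNReal.add_div, ENNReal.div_eq_div_iff] <;> norm_num

end Selection

/-! ### Release probabilities -/

/-- Write r A - 1 = r (A - 1) + (r - 1). In the first summand one factor r comes from the numerator
and another from comparing the denominators. The second is charged to `d`, since by AM-GM the
denominator is at least 2 (G - 1). -/
theorem release_step_aux {A B r G d : ℝ} (hA : 1 ≤ A) (hr : 1 ≤ r) (hB : r ≤ B) (hG : 1 < G)
    (hGAB : G ^ 2 = A * B) (hd : r - 1 ≤ d * (2 * (G - 1))) :
    (r * A - 1) / ((r * A - 1) + (B / r - 1)) ≤ r ^ 2 * ((A - 1) / ((A - 1) + (B - 1))) + d := by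
  have hr0 : 0 < r := by linarith
  have hBr : r * (B / r) = B := by field_simp
  have hBr1 : 1 ≤ B / r := by rw [le_div_iff₀ hr0]; linarith
  have hamgm : 2 * G ≤ r * A + B / r := by
    refine abs_le_of_sq_le_sq' ?_ (by nlinarith) |>.2
    nlinarith [sq_nonneg (r * A - B / r)]
  have hamgm' : 2 * G ≤ A + B := by
    refine abs_le_of_sq_le_sq' ?_ (by nlinarith) |>.2
    nlinarith [sq_nonneg (A - B)]
  have hden' : 0 < (r * A - 1) + (B / r - 1) := by linarith
  have hden : 0 < (A - 1) + (B - 1) := by linarith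
  have hd0 : 0 ≤ d := by
    by_contra! h
    nlinarith
  have hfrac : (A - 1) / ((A - 1) + (B - 1)) * ((A - 1) + (B - 1)) = A - 1 :=
    div_mul_cancel₀ _ hden.ne'
  have hfrac0 : 0 ≤ (A - 1) / ((A - 1) + (B - 1)) := div_nonneg (by linarith) hden.le
  set φ := (A - 1) / ((A - 1) + (B - 1))
  have hcmp : (A - 1) + (B - 1) ≤ r * ((r * A - 1) + (B / r - 1)) := by
    nlinarith [mul_nonneg (sub_nonneg.2 hr) (sub_nonneg.2 hA),
      mul_nonneg (mul_nonneg (sub_nonneg.2 hr) (sub_nonneg.2 hA)) hr0.le]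
  rw [div_le_iff₀ hden', add_mul]
  have h1 : r - 1 ≤ d * ((r * A - 1) + (B / r - 1)) :=
    hd.trans (mul_le_mul_of_nonneg_left (by linarith) hd0)
  have h2 : r * (A - 1) ≤ r ^ 2 * φ * ((r * A - 1) + (B / r - 1)) := by
    have := mul_le_mul_of_nonneg_left hcmp (mul_nonneg hr0.le hfrac0)
    nlinarith
  linarith

/-- The probability with which a bin with count `c` is released: it vanishes at `0`, equals one from
`T` on, and is stable under unit changes of `c`. -/
noncomputable def releaseProb (ε : ℝ) (T c : ℕ) : ℝ :=
  (Real.exp (ε * min c T) - 1) /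
    ((Real.exp (ε * min c T) - 1) + (Real.exp (ε * (T - min c T : ℝ)) - 1))

section ReleaseProb

variable {ε d : ℝ} {T : ℕ}

theorem releaseProb_zero : releaseProb ε T 0 = 0 := by simp [releaseProb]

theorem releaseProb_of_le (hε : 0 < ε) (hT : 0 < T) {c : ℕ} (hc : T ≤ c) :
    releaseProb ε T c = 1 := by
  have hT0 : (0 : ℝ) < T := by exact_mod_cast hT
  have h : ((min c T : ℕ) : ℝ) = T := by rw [min_eq_right hc]
  have h1 : 0 < Real.exp (ε * T) - 1 := by
    have := Real.add_one_le_exp (ε * T)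
    nlinarith [mul_pos hε hT0]
  simp only [releaseProb, h, sub_self, mul_zero, Real.exp_zero, add_zero]
  exact div_self h1.ne'

theorem releaseProb_terms_nonneg (hε : 0 < ε) (c : ℕ) : 0 ≤ Real.exp (ε * min c T) - 1 ∧
    0 ≤ Real.exp (ε * (T - min c T : ℝ)) - 1 := by
  constructor
  · exact sub_nonneg.2 (Real.one_le_exp (by positivity))
  · refine sub_nonneg.2 (Real.one_le_exp (mul_nonneg hε.le (sub_nonneg.2
      (by exact_mod_cast min_le_right c T))))

theorem releaseProb_nonneg (hε : 0 < ε) (c : ℕ) : 0 ≤ releaseProb ε T c := by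
  obtain ⟨h1, h2⟩ := releaseProb_terms_nonneg (T := T) hε c
  exact div_nonneg h1 (add_nonneg h1 h2)

theorem releaseProb_le_one (hε : 0 < ε) (c : ℕ) : releaseProb ε T c ≤ 1 := by
  obtain ⟨h1, h2⟩ := releaseProb_terms_nonneg (T := T) hε c
  exact div_le_one_of_le₀ (by linarith) (add_nonneg h1 h2)

/-- Below `T`, with A = exp(εc) and B = exp(ε(T - c)), a unit step multiplies A by exp(ε) and
divides B by it, while AB stays fixed. The additive error `d` is forced by probabilities 0 and 1 at
the ends, and the condition on `d` asks for `T` of order log(1/d)/ε. -/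
theorem releaseProb_succ (hε : 0 < ε) (hT : 0 < T)
    (hd : Real.exp ε - 1 ≤ d * (2 * (Real.exp (ε * T / 2) - 1))) (c : ℕ) :
    releaseProb ε T c ≤ releaseProb ε T (c + 1) ∧
    releaseProb ε T (c + 1) ≤ Real.exp (2 * ε) * releaseProb ε T c + d ∧
    1 - releaseProb ε T c ≤ Real.exp (2 * ε) * (1 - releaseProb ε T (c + 1)) + d := by
  have hT0 : (0 : ℝ) < T := by exact_mod_cast hT
  set G := Real.exp (ε * T / 2) with hG
  have hG1 : 1 < G := Real.one_lt_exp_iff.2 (by positivity)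
  have hr : 1 < Real.exp ε := Real.one_lt_exp_iff.2 hε
  have hd0 : 0 ≤ d := by
    by_contra! h
    nlinarith
  rcases le_or_gt T c with hc | hc
  · rw [releaseProb_of_le hε hT hc, releaseProb_of_le hε hT (hc.trans (Nat.le_succ c))]
    have : 1 ≤ Real.exp (2 * ε) := Real.one_le_exp (by positivity)
    refine ⟨le_rfl, by linarith, by linarith⟩
  · have hc' : (c : ℝ) + 1 ≤ T := by exact_mod_cast hc
    have hm : ((min c T : ℕ) : ℝ) = c := by rw [min_eq_left hc.le]
    have hm' : ((min (c + 1) T : ℕ) : ℝ) = c + 1 := by rw [min_eq_left hc]; push_cast; rfl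
    set r := Real.exp ε with hr'
    set A := Real.exp (ε * c) with hA
    set B := Real.exp (ε * (T - c)) with hB
    have hA1 : 1 ≤ A := Real.one_le_exp (by positivity)
    have hBr : r ≤ B := Real.exp_le_exp.2 (by nlinarith)
    have hAr : Real.exp (ε * (c + 1)) = r * A := by rw [hr', hA, ← Real.exp_add]; congr 1; ring
    have hBr' : Real.exp (ε * (T - (c + 1))) = B / r := by
      rw [hr', hB, ← Real.exp_sub]; congr 1; ring
    have hGAB : G ^ 2 = A * B := by
      rw [hG, hA, hB, ← Real.exp_add, ← Real.exp_nat_mul]; congr 1; push_cast; ring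
    have hr2 : Real.exp (2 * ε) = r ^ 2 := by
      rw [hr', ← Real.exp_nat_mul]; congr 1
    have hr0 : 0 < r := by linarith
    have hB1 : 1 ≤ B / r := by rw [le_div_iff₀ hr0]; linarith
    have hBB : B / r ≤ B := div_le_self (by linarith) hr.le
    have hAA : A ≤ r * A := by nlinarith
    have hden' : 0 < (r * A - 1) + (B / r - 1) := by nlinarith
    have hden : 0 < (A - 1) + (B - 1) := by nlinarith
    have e1 : releaseProb ε T c = (A - 1) / ((A - 1) + (B - 1)) := by
      simp only [releaseProb, hm, hA, hB]
    have e2 : releaseProb ε T (c + 1) = (r * A - 1) / ((r * A - 1) + (B / r - 1)) := by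
      simp only [releaseProb, hm', hAr, hBr']
    -- Replacing c by T - c exchanges the probabilities of release and omission, so the third
    -- inequality is the second read backwards, with B / r and r A in place of A and B.
    have e3 : 1 - releaseProb ε T c =
        (r * (B / r) - 1) / ((r * (B / r) - 1) + (r * A / r - 1)) := by
      rw [e1, mul_div_cancel₀ _ hr0.ne', mul_div_cancel_left₀ _ hr0.ne', add_comm (B - 1)]
      field_simp
      ring
    have e4 : 1 - releaseProb ε T (c + 1) = (B / r - 1) / ((B / r - 1) + (r * A - 1)) := by
      rw [e2, add_comm (B / r - 1), eq_div_iff hden'.ne', sub_mul, div_mul_cancel₀ _ hden'.ne']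
      ring
    refine ⟨?_, ?_, ?_⟩
    · rw [e1, e2, div_le_div_iff₀ hden hden']
      nlinarith [mul_nonneg (sub_nonneg.2 hAA) (sub_nonneg.2 (hr.le.trans hBr)),
        mul_nonneg (sub_nonneg.2 hBB) (sub_nonneg.2 hA1)]
    · rw [e1, e2, hr2]
      exact release_step_aux hA1 hr.le hBr hG1 hGAB hd
    · rw [e3, e4, hr2]
      refine release_step_aux hB1 hr.le (by nlinarith) hG1 ?_ hd
      rw [hGAB]; field_simp

end ReleaseProb

/-! ### Indistinguishable measures -/

/-- `(ε, δ)`-indistinguishability, tested on functions with values in `[0, 1]`. -/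
def Indist {O : Type*} [MeasurableSpace O] (ε δ : ℝ) (P Q : Measure O) : Prop :=
  ∀ f : O → ℝ≥0∞, Measurable f → (∀ y, f y ≤ 1) →
    ∫⁻ y, f y ∂P ≤ ENNReal.ofReal (Real.exp ε) * ∫⁻ y, f y ∂Q + ENNReal.ofReal δ

theorem Indist.trans {O : Type*} [MeasurableSpace O] {ε₁ δ₁ ε₂ δ₂ : ℝ} {P Q P' : Measure O}
    (hδ₁ : 0 ≤ δ₁) (hδ₂ : 0 ≤ δ₂) (h₁ : Indist ε₁ δ₁ P Q) (h₂ : Indist ε₂ δ₂ Q P') :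
    Indist (ε₁ + ε₂) (δ₁ + Real.exp ε₁ * δ₂) P P' := by
  intro f hf hf1
  calc ∫⁻ y, f y ∂P ≤ ENNReal.ofReal (Real.exp ε₁) * ∫⁻ y, f y ∂Q + ENNReal.ofReal δ₁ := h₁ f hf hf1
    _ ≤ ENNReal.ofReal (Real.exp ε₁) * (ENNReal.ofReal (Real.exp ε₂) * ∫⁻ y, f y ∂P'
          + ENNReal.ofReal δ₂) + ENNReal.ofReal δ₁ := by gcongr; exact h₂ f hf hf1
    _ = _ := by
        rw [Real.exp_add, ENNReal.ofReal_mul (Real.exp_pos _).le,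
          ENNReal.ofReal_add hδ₁ (mul_nonneg (Real.exp_pos _).le hδ₂),
          ENNReal.ofReal_mul (Real.exp_pos _).le]
        ring

theorem Indist.mono {O : Type*} [MeasurableSpace O] {ε δ ε' δ' : ℝ} {P Q : Measure O}
    (h : Indist ε δ P Q) (hε : ε ≤ ε') (hδ : δ ≤ δ') : Indist ε' δ' P Q := fun f hf hf1 =>
  (h f hf hf1).trans (by gcongr)

/-! ### Random subsets of bins -/

section RandomSubset

variable {B : Type*} [DecidableEq B]

/-- The expectation of `f` over the random subset of `F` that contains `b ∈ F`
independently with probability `p b`. -/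
noncomputable def subsetExp (p : B → ℝ) (F : Finset B) (f : Finset B → ℝ≥0∞) : ℝ≥0∞ :=
  ∑ Y ∈ F.powerset, (∏ b ∈ Y, ENNReal.ofReal (p b)) * (∏ b ∈ F \ Y, ENNReal.ofReal (1 - p b)) * f Y

/-- Conditioning on whether `b` is chosen; it isolates a single coin. -/
theorem subsetExp_insert (p : B → ℝ) {F : Finset B} {b : B} (hb : b ∉ F) (f : Finset B → ℝ≥0∞) :
    subsetExp p (insert b F) f = ENNReal.ofReal (1 - p b) * subsetExp p F f
      + ENNReal.ofReal (p b) * subsetExp p F (fun Y => f (insert b Y)) := by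
  unfold subsetExp
  rw [Finset.sum_powerset_insert hb, Finset.mul_sum, Finset.mul_sum]
  congr 1
  · refine Finset.sum_congr rfl fun Y hY => ?_
    have hbY : b ∉ Y := fun h => hb (Finset.mem_powerset.1 hY h)
    rw [Finset.insert_sdiff_of_notMem _ hbY, Finset.prod_insert (by simp [hb])]
    ring
  · refine Finset.sum_congr rfl fun Y hY => ?_
    have hbY : b ∉ Y := fun h => hb (Finset.mem_powerset.1 hY h)
    have : insert b F \ insert b Y = F \ Y := by
      rw [Finset.insert_sdiff_insert, Finset.sdiff_insert_of_notMem hb]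
    rw [this, Finset.prod_insert hbY]
    ring

theorem subsetExp_one {p : B → ℝ} (h0 : ∀ b, 0 ≤ p b) (h1 : ∀ b, p b ≤ 1) (F : Finset B) :
    subsetExp p F (fun _ => 1) = 1 := by
  unfold subsetExp
  simp only [mul_one]
  rw [← Finset.prod_add]
  refine Finset.prod_eq_one fun b _ => ?_
  rw [← ENNReal.ofReal_add (h0 b) (sub_nonneg.2 (h1 b)), add_sub_cancel, ENNReal.ofReal_one]

theorem subsetExp_mono (p : B → ℝ) (F : Finset B) {f g : Finset B → ℝ≥0∞} (h : ∀ Y, f Y ≤ g Y) :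
    subsetExp p F f ≤ subsetExp p F g :=
  Finset.sum_le_sum fun Y _ => by gcongr; exact h Y

theorem subsetExp_congr {p p' : B → ℝ} {F : Finset B} (h : ∀ b ∈ F, p b = p' b)
    (f : Finset B → ℝ≥0∞) : subsetExp p F f = subsetExp p' F f := by
  refine Finset.sum_congr rfl fun Y hY => ?_
  rw [Finset.prod_congr rfl fun b hb => by rw [h b (Finset.mem_powerset.1 hY hb)],
    Finset.prod_congr (s₁ := F \ Y) rfl fun b hb => by rw [h b (Finset.mem_sdiff.1 hb).1]]

/-- Elements of probability zero can be added to the ground set. This puts the releases of two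
datasets, whose nonempty bins differ, on a common ground set. -/
theorem subsetExp_eq_of_subset {p : B → ℝ} {F F' : Finset B} (hF : F ⊆ F')
    (h : ∀ b ∉ F, p b = 0) (f : Finset B → ℝ≥0∞) : subsetExp p F' f = subsetExp p F f := by
  rw [← Finset.union_sdiff_of_subset hF]
  have : ∀ E : Finset B, Disjoint E F → subsetExp p (F ∪ E) f = subsetExp p F f := by
    intro E
    induction E using Finset.induction_on with
    | empty => simp
    | insert b E hb ih =>
      intro hd
      rw [Finset.disjoint_insert_left] at hd
      rw [Finset.union_insert, subsetExp_insert _ (by simp [hb, hd.1]), h b hd.1, ih hd.2]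
      simp
  exact this _ Finset.sdiff_disjoint

/-- Changing the inclusion probability of a single element. -/
theorem subsetExp_le_of_eq_off {p p' : B → ℝ} (h0 : ∀ b, 0 ≤ p b) (h1 : ∀ b, p b ≤ 1)
    {b : B} (h : ∀ b' ≠ b, p b' = p' b') {r d : ℝ} (hr : 1 ≤ r) (hd : 0 ≤ d)
    (hle : p' b ≤ r * p b + d ∧ 1 - p' b ≤ r * (1 - p b) ∨
      p' b ≤ r * p b ∧ 1 - p' b ≤ r * (1 - p b) + d) {F : Finset B} (hb : b ∈ F)
    {f : Finset B → ℝ≥0∞} (hf : ∀ Y, f Y ≤ 1) :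
    subsetExp p' F f ≤ ENNReal.ofReal r * subsetExp p F f + ENNReal.ofReal d := by
  rw [← Finset.insert_erase hb, subsetExp_insert _ (Finset.notMem_erase _ _),
    subsetExp_insert _ (Finset.notMem_erase _ _)]
  have hc : ∀ g : Finset B → ℝ≥0∞, subsetExp p' (F.erase b) g = subsetExp p (F.erase b) g :=
    fun g => (subsetExp_congr (fun b' hb' => h b' (Finset.ne_of_mem_erase hb')) g).symm
  rw [hc, hc]
  set E₀ := subsetExp p (F.erase b) f
  set E₁ := subsetExp p (F.erase b) fun Y => f (insert b Y)
  have hE₀ : E₀ ≤ 1 := (subsetExp_mono p _ hf).trans (subsetExp_one h0 h1 _).le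
  have hE₁ : E₁ ≤ 1 := (subsetExp_mono p _ fun Y => hf _).trans (subsetExp_one h0 h1 _).le
  have hr0 : 0 ≤ r := by linarith
  have hq : 0 ≤ 1 - p b := sub_nonneg.2 (h1 b)
  have hof : ∀ {a c : ℝ}, 0 ≤ c → a ≤ r * c + d →
      ENNReal.ofReal a ≤ ENNReal.ofReal r * ENNReal.ofReal c + ENNReal.ofReal d := by
    intro a c hc h
    rw [← ENNReal.ofReal_mul hr0, ← ENNReal.ofReal_add (mul_nonneg hr0 hc) hd]
    exact ENNReal.ofReal_le_ofReal h
  have hof' : ∀ {a c : ℝ}, a ≤ r * c →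
      ENNReal.ofReal a ≤ ENNReal.ofReal r * ENNReal.ofReal c := by
    intro a c h
    rw [← ENNReal.ofReal_mul hr0]
    exact ENNReal.ofReal_le_ofReal h
  -- Only one outcome of the coin carries the additive error, and both conditional expectations are
  -- at most 1, so the total error is `d` and not twice that.
  rcases hle with ⟨ha, hb'⟩ | ⟨ha, hb'⟩
  · calc _ ≤ (ENNReal.ofReal r * ENNReal.ofReal (1 - p b)) * E₀
          + (ENNReal.ofReal r * ENNReal.ofReal (p b) + ENNReal.ofReal d) * E₁ := by
          gcongr
          · exact hof' hb'
          · exact hof (h0 b) ha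
      _ = ENNReal.ofReal r * (ENNReal.ofReal (1 - p b) * E₀ + ENNReal.ofReal (p b) * E₁)
          + ENNReal.ofReal d * E₁ := by ring
      _ ≤ _ := by
          gcongr
          exact mul_le_of_le_one_right zero_le hE₁
  · calc _ ≤ (ENNReal.ofReal r * ENNReal.ofReal (1 - p b) + ENNReal.ofReal d) * E₀
          + (ENNReal.ofReal r * ENNReal.ofReal (p b)) * E₁ := by
          gcongr
          · exact hof hq hb'
          · exact hof' ha
      _ = ENNReal.ofReal r * (ENNReal.ofReal (1 - p b) * E₀ + ENNReal.ofReal (p b) * E₁)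
          + ENNReal.ofReal d * E₀ := by ring
      _ ≤ _ := by
          gcongr
          exact mul_le_of_le_one_right zero_le hE₀

end RandomSubset

/-! ### Releasing the heavy bins -/

section Release

variable {B : Type*} [DecidableEq B] {n : ℕ}

/-- The number of entries of `β` that equal `b`. -/
def binCount (β : Fin n → B) (b : B) : ℕ := (Finset.univ.filter fun a => β a = b).card

theorem binCount_eq_zero {β : Fin n → B} {b : B} (hb : b ∉ Finset.univ.image β) :
    binCount β b = 0 := by
  rw [binCount, Finset.card_eq_zero, Finset.filter_eq_empty_iff]
  exact fun a _ h => hb (Finset.mem_image.2 ⟨a, Finset.mem_univ _, h⟩)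

/-- The law of the random subset of `F` that contains `b ∈ F` independently with
probability `p b`. -/
noncomputable def subsetLaw (p : B → ℝ) (F : Finset B) : Measure (Finset B) :=
  ∑ Y ∈ F.powerset, ((∏ b ∈ Y, ENNReal.ofReal (p b)) * ∏ b ∈ F \ Y, ENNReal.ofReal (1 - p b)) •
    Measure.dirac Y

theorem lintegral_subsetLaw [Countable B] (p : B → ℝ) (F : Finset B) (f : Finset B → ℝ≥0∞) :
    ∫⁻ Y, f Y ∂(subsetLaw p F) = subsetExp p F f := by
  simp only [subsetLaw, subsetExp, lintegral_finsetSum_measure, lintegral_smul_measure,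
    lintegral_dirac, smul_eq_mul]

/-- Every nonempty bin is released independently, with a probability that depends on its count. -/
noncomputable def releaseLaw (ε : ℝ) (T : ℕ) (β : Fin n → B) : Measure (Finset B) :=
  subsetLaw (fun b => releaseProb ε T (binCount β b)) (Finset.univ.image β)

theorem isProbabilityMeasure_releaseLaw [Countable B] {ε : ℝ} (hε : 0 < ε) (T : ℕ)
    (β : Fin n → B) : IsProbabilityMeasure (releaseLaw ε T β) := by
  constructor
  rw [← lintegral_one, releaseLaw, lintegral_subsetLaw]
  exact subsetExp_one (fun _ => releaseProb_nonneg hε _) (fun _ => releaseProb_le_one hε _) _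

theorem lintegral_releaseLaw [Countable B] (ε : ℝ) (T : ℕ) {β : Fin n → B} {F : Finset B}
    (hF : Finset.univ.image β ⊆ F) (f : Finset B → ℝ≥0∞) :
    ∫⁻ Y, f Y ∂(releaseLaw ε T β)
      = subsetExp (fun b => releaseProb ε T (binCount β b)) F f := by
  rw [releaseLaw, lintegral_subsetLaw]
  refine (subsetExp_eq_of_subset hF (fun b hb => ?_) f).symm
  rw [binCount_eq_zero hb, releaseProb_zero]

/-- Only nonempty bins are candidates, which bounds the cardinality by n. A bin of count at least
`T` has omission probability zero, so subsets that miss it have weight zero. -/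
theorem ae_releaseLaw [Countable B] {ε : ℝ} (hε : 0 < ε) {T : ℕ} (hT : 0 < T) (β : Fin n → B) :
    ∀ᵐ Y ∂(releaseLaw ε T β), Y.card ≤ n ∧ ∀ b, T ≤ binCount β b → b ∈ Y := by
  classical
  set S : Set (Finset B) := {Y | Y.card ≤ n ∧ ∀ b, T ≤ binCount β b → b ∈ Y}
  change releaseLaw ε T β Sᶜ = 0
  rw [← lintegral_indicator_one (MeasurableSet.of_discrete), releaseLaw, lintegral_subsetLaw]
  refine Finset.sum_eq_zero fun Y hY => ?_
  by_cases hYS : Y ∈ S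
  · rw [Set.indicator_of_notMem (by simpa using hYS), mul_zero]
  · have hcard : Y.card ≤ n := by
      refine (Finset.card_le_card (Finset.mem_powerset.1 hY)).trans ?_
      exact Finset.card_image_le.trans (by simp)
    obtain ⟨b, hb, hbY⟩ : ∃ b, T ≤ binCount β b ∧ b ∉ Y := by
      by_contra! h
      exact hYS ⟨hcard, h⟩
    have hbF : b ∈ Finset.univ.image β := by
      by_contra h
      rw [binCount_eq_zero h] at hb
      omega
    rw [Finset.prod_eq_zero (Finset.mem_sdiff.2 ⟨hbF, hbY⟩), mul_zero, zero_mul]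
    simp only [releaseProb_of_le hε hT hb, sub_self, ENNReal.ofReal_zero]

/-- A unit change of a single count. -/
theorem subsetExp_release_step {ε d : ℝ} {T : ℕ} (hε : 0 < ε) (hT : 0 < T)
    (hd0 : 0 ≤ d) (hd : Real.exp ε - 1 ≤ d * (2 * (Real.exp (ε * T / 2) - 1)))
    {c c' : B → ℕ} {b : B} (hc : c' b = c b + 1) (hcc : ∀ b' ≠ b, c' b' = c b')
    {F : Finset B} (hb : b ∈ F)
    {f : Finset B → ℝ≥0∞} (hf : ∀ Y, f Y ≤ 1) :
    subsetExp (fun b => releaseProb ε T (c' b)) F f ≤ ENNReal.ofReal (Real.exp (2 * ε)) *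
        subsetExp (fun b => releaseProb ε T (c b)) F f + ENNReal.ofReal d ∧
    subsetExp (fun b => releaseProb ε T (c b)) F f ≤ ENNReal.ofReal (Real.exp (2 * ε)) *
        subsetExp (fun b => releaseProb ε T (c' b)) F f + ENNReal.ofReal d := by
  obtain ⟨h1, h2, h3⟩ := releaseProb_succ hε hT hd (c b)
  have hr : 1 ≤ Real.exp (2 * ε) := Real.one_le_exp (by positivity)
  have hp0 := releaseProb_nonneg (T := T) hε (c b)
  have hp1 := releaseProb_le_one (T := T) hε (c b + 1)
  constructor
  · refine subsetExp_le_of_eq_off (fun _ => releaseProb_nonneg hε _)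
      (fun _ => releaseProb_le_one hε _) (b := b) (fun b' hb' => by rw [hcc b' hb']) hr hd0 ?_ hb hf
    -- A larger count raises the release probability, so omission needs no additive error; in the
    -- reverse comparison the roles are exchanged.
    left
    rw [hc]
    exact ⟨h2, by nlinarith⟩
  · refine subsetExp_le_of_eq_off (fun _ => releaseProb_nonneg hε _)
      (fun _ => releaseProb_le_one hε _) (b := b) (fun b' hb' => by rw [hcc b' hb']) hr hd0 ?_ hb hf
    right
    rw [hc]
    exact ⟨by nlinarith, h3⟩

/-- Moving an entry means removing it and adding it elsewhere: two unit steps through the counts `c`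
of the other entries. -/
theorem indist_releaseLaw_update [Countable B] {ε d : ℝ} {T : ℕ} (hε : 0 < ε) (hT : 0 < T)
    (hd0 : 0 ≤ d) (hd : Real.exp ε - 1 ≤ d * (2 * (Real.exp (ε * T / 2) - 1)))
    (β : Fin n → B) (a : Fin n) (b : B) :
    Indist (4 * ε) (d + Real.exp (2 * ε) * d) (releaseLaw ε T (Function.update β a b))
      (releaseLaw ε T β) := by
  intro f _ hf1
  set β' := Function.update β a b with hβ'
  set F := Finset.univ.image β ∪ Finset.univ.image β' with hF
  rw [lintegral_releaseLaw ε T (F := F) Finset.subset_union_left,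
    lintegral_releaseLaw ε T (F := F) Finset.subset_union_right]
  set c : B → ℕ := fun b => ((Finset.univ.erase a).filter fun a' => β a' = b).card with hc
  have hcount : ∀ γ : Fin n → B, (∀ a' ≠ a, γ a' = β a') →
      binCount γ (γ a) = c (γ a) + 1 ∧ ∀ b' ≠ γ a, binCount γ b' = c b' := by
    intro γ hγ
    have h1 : ∀ b', (Finset.univ.erase a).filter (fun a' => γ a' = b')
        = (Finset.univ.erase a).filter fun a' => β a' = b' := fun b' =>
      Finset.filter_congr fun a' ha' => by rw [hγ a' (Finset.ne_of_mem_erase ha')]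
    have h2 : (Finset.univ : Finset (Fin n)) = insert a (Finset.univ.erase a) :=
      (Finset.insert_erase (Finset.mem_univ a)).symm
    constructor
    · rw [binCount, h2, Finset.filter_insert, if_pos rfl, Finset.card_insert_of_notMem (by simp),
        h1]
    · intro b' hb'
      rw [binCount, h2, Finset.filter_insert, if_neg (Ne.symm hb'), h1]
  obtain ⟨e1, e2⟩ := hcount β fun _ _ => rfl
  obtain ⟨e3, e4⟩ := hcount β' fun a' ha' => Function.update_of_ne ha' _ _
  have s1 := (subsetExp_release_step hε hT hd0 hd e1 e2 (F := F) (Finset.mem_union_left _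
    (Finset.mem_image_of_mem _ (Finset.mem_univ a))) hf1).2
  have s2 := (subsetExp_release_step hε hT hd0 hd e3 e4 (F := F) (Finset.mem_union_right _
    (Finset.mem_image_of_mem _ (Finset.mem_univ a))) hf1).1
  set r := ENNReal.ofReal (Real.exp (2 * ε)) with hr
  have hrr : ENNReal.ofReal (Real.exp (4 * ε)) = r * r := by
    rw [hr, ← ENNReal.ofReal_mul (Real.exp_pos _).le, ← Real.exp_add]; congr 2; ring
  have hdd : ENNReal.ofReal (d + Real.exp (2 * ε) * d) =
      ENNReal.ofReal d + r * ENNReal.ofReal d := by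
    rw [ENNReal.ofReal_add hd0 (by positivity), ENNReal.ofReal_mul (Real.exp_pos _).le]
  rw [hrr, hdd]
  refine s2.trans ?_
  calc _ ≤ r * (r * subsetExp (fun b => releaseProb ε T (binCount β b)) F f + ENNReal.ofReal d)
        + ENNReal.ofReal d := by gcongr
    _ = _ := by ring

/-- Three entries with two unit steps each make six steps of cost 2(ε/12), that is ε in total. The
errors δ/36 per step, inflated by exponentials of at most 3/2, sum to less than δ. The bound on `T`
makes the per-step condition hold, because exp(ε/12) - 1 < 2. -/
theorem indist_releaseLaw [Countable B] {ε δ : ℝ} {T : ℕ} (hε : 0 < ε) (hε1 : ε ≤ 1) (hδ : 0 < δ)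
    (hT : 24 * Real.log (1 + 36 / δ) / ε ≤ T) {β β' : Fin n → B} {a₁ a₂ a₃ : Fin n}
    (h : ∀ a, a ≠ a₁ → a ≠ a₂ → a ≠ a₃ → β a = β' a) :
    Indist ε δ (releaseLaw (ε / 12) T β') (releaseLaw (ε / 12) T β) := by
  have hlog : 0 < Real.log (1 + 36 / δ) :=
    Real.log_pos (by linarith [div_pos (by norm_num : (0 : ℝ) < 36) hδ])
  have hT0 : 0 < T := by
    have : (0 : ℝ) < T := lt_of_lt_of_le (by positivity) hT
    exact_mod_cast this
  have he1 := Real.exp_one_lt_d9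
  have hd : Real.exp (ε / 12) - 1 ≤ δ / 36 * (2 * (Real.exp (ε / 12 * T / 2) - 1)) := by
    have h1 : Real.log (1 + 36 / δ) ≤ ε / 12 * T / 2 := by
      rw [div_le_iff₀ hε] at hT
      linarith
    have h2 : 1 + 36 / δ ≤ Real.exp (ε / 12 * T / 2) := by
      rw [← Real.exp_log (by positivity : 0 < 1 + 36 / δ)]
      exact Real.exp_le_exp.2 h1
    have h3 : Real.exp (ε / 12) ≤ Real.exp 1 := Real.exp_le_exp.2 (by linarith)
    have h4 : δ / 36 * (2 * (36 / δ)) ≤ δ / 36 * (2 * (Real.exp (ε / 12 * T / 2) - 1)) := by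
      gcongr; linarith
    have h5 : δ / 36 * (2 * (36 / δ)) = 2 := by field_simp
    linarith
  set d₁ := δ / 36 + Real.exp (2 * (ε / 12)) * (δ / 36) with hd₁
  have hd₁0 : 0 ≤ d₁ := by positivity
  have hstep : ∀ (γ : Fin n → B) (a : Fin n) (b : B), Indist (ε / 3) d₁
      (releaseLaw (ε / 12) T (Function.update γ a b)) (releaseLaw (ε / 12) T γ) := by
    intro γ a b
    have := indist_releaseLaw_update (by positivity : 0 < ε / 12) hT0 (by positivity) hd γ a b
    rwa [show 4 * (ε / 12) = ε / 3 by ring] at this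
  have heq : β' = Function.update (Function.update (Function.update β a₁ (β' a₁)) a₂ (β' a₂)) a₃
      (β' a₃) := by
    funext a
    by_cases h3 : a = a₃
    · subst h3; simp
    · by_cases h2 : a = a₂
      · subst h2; simp [h3]
      · by_cases h1 : a = a₁
        · subst h1; simp [h3, h2]
        · simp [h1, h2, h3, h a h1 h2 h3]
  have t1 := (hstep (Function.update β a₁ (β' a₁)) a₂ (β' a₂)).trans hd₁0 hd₁0 (hstep β a₁ (β' a₁))
  have t2 := (hstep (Function.update (Function.update β a₁ (β' a₁)) a₂ (β' a₂)) a₃ (β' a₃)).trans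
    hd₁0 (by positivity) t1
  rw [← heq] at t2
  refine t2.mono (by linarith) ?_
  have hE : ∀ s, s ≤ 1 / 3 → Real.exp s ≤ 3 / 2 := by
    intro s hs
    refine (Real.exp_le_exp.2 hs).trans ?_
    have : Real.exp (1 / 3) ^ 3 ≤ (3 / 2) ^ 3 := by
      rw [← Real.exp_nat_mul]
      norm_num
      linarith
    exact le_of_pow_le_pow_left₀ (by norm_num) (by norm_num) this
  have q1 := hE (ε / 3) (by linarith)
  have q2 := hE (2 * (ε / 12)) (by linarith)
  have q3 : d₁ ≤ 5 / 72 * δ := by rw [hd₁]; nlinarith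
  have q4 : 0 < Real.exp (ε / 3) := Real.exp_pos _
  have q5 : Real.exp (ε / 3) * d₁ ≤ 3 / 2 * d₁ := mul_le_mul_of_nonneg_right q1 hd₁0
  have q6 : Real.exp (ε / 3) * (d₁ + Real.exp (ε / 3) * d₁) ≤ 3 / 2 * (d₁ + 3 / 2 * d₁) :=
    mul_le_mul q1 (by linarith) (by positivity) (by norm_num)
  linarith

end Release

/-! ### Gaps and bins of a dataset -/

section Gaps

variable {n : ℕ}

/-- The lexicographic order of the entries of a dataset: by value, then by index. -/
def LexLT (x : Fin n → ℝ) (a b : Fin n) : Prop := x a < x b ∨ x a = x b ∧ a < b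

theorem LexLT.le {x : Fin n → ℝ} {a b : Fin n} (h : LexLT x a b) : x a ≤ x b := by
  rcases h with h | h
  · exact h.le
  · exact h.1.le

theorem lexLT_or_lexLT (x : Fin n → ℝ) {a b : Fin n} (h : a ≠ b) : LexLT x a b ∨ LexLT x b a := by
  unfold LexLT
  rcases lt_trichotomy (x a) (x b) with h1 | h1 | h1
  · simp [h1]
  · rcases lt_or_gt_of_ne h with h2 | h2 <;> simp [h1, h2]
  · simp [h1]

open Classical in
/-- The distance of the entry `a` from the next entry in lexicographic order. -/
noncomputable def gap (x : Fin n → ℝ) (a : Fin n) : ℝ≥0∞ :=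
  ⨅ b, if LexLT x a b then ENNReal.ofReal (x b - x a) else ⊤

theorem measurable_gap (a : Fin n) : Measurable fun x : Fin n → ℝ => gap x a := by
  unfold gap
  refine Measurable.iInf fun b => Measurable.ite ?_ ?_ measurable_const
  · have ha : Measurable fun x : Fin n → ℝ => x a := measurable_pi_apply a
    have hb : Measurable fun x : Fin n → ℝ => x b := measurable_pi_apply b
    exact (measurableSet_lt ha hb).union
      ((measurableSet_eq_fun ha hb).inter (MeasurableSet.const _))
  · exact ((measurable_pi_apply b).sub (measurable_pi_apply a)).ennreal_ofReal

theorem gap_le {x : Fin n → ℝ} {a b : Fin n} (h : LexLT x a b) :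
    gap x a ≤ ENNReal.ofReal (x b - x a) :=
  (iInf_le _ b).trans (by rw [if_pos h])

open Classical in
/-- The distance of the entry `a` from the next entry other than `j` in lexicographic order. -/
noncomputable def gapExcept (x : Fin n → ℝ) (j a : Fin n) : ℝ≥0∞ :=
  ⨅ b, if b ≠ j ∧ LexLT x a b then ENNReal.ofReal (x b - x a) else ⊤

theorem gapExcept_congr {x x' : Fin n → ℝ} {j : Fin n} (h : ∀ i, i ≠ j → x i = x' i) {a : Fin n}
    (ha : a ≠ j) : gapExcept x j a = gapExcept x' j a := by
  unfold gapExcept LexLT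
  refine iInf_congr fun b => ?_
  by_cases hb : b = j
  · simp [hb]
  · simp [hb, h a ha, h b hb]

/-- Omitting `j` matters for `a` only if `j` follows `a` and is strictly nearer than every other
successor. -/
theorem lexLT_of_gap_ne {x : Fin n → ℝ} {j a : Fin n} (h : gap x a ≠ gapExcept x j a) :
    LexLT x a j ∧ ENNReal.ofReal (x j - x a) < gapExcept x j a := by
  by_contra hc
  refine h (le_antisymm ?_ ?_)
  · refine le_iInf fun b => ?_
    split_ifs with hb
    · exact gap_le hb.2
    · exact le_top
  · refine le_iInf fun b => ?_
    split_ifs with hb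
    · by_cases hbj : b = j
      · subst hbj
        by_contra! hlt
        exact hc ⟨hb, hlt⟩
      · exact (iInf_le _ b).trans (by rw [if_pos ⟨hbj, hb⟩])
    · exact le_top

/-- Only the immediate predecessor of `j` can be affected: if `a` comes before `a'` and both come
before `j`, then `a'` is a successor of `a` no farther than `j`. -/
theorem eq_of_gap_ne {x : Fin n → ℝ} {j a a' : Fin n} (haj : a ≠ j) (haj' : a' ≠ j)
    (h : gap x a ≠ gapExcept x j a) (h' : gap x a' ≠ gapExcept x j a') : a = a' := by
  have key : ∀ {a a' : Fin n}, a' ≠ j → gap x a ≠ gapExcept x j a →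
      gap x a' ≠ gapExcept x j a' → ¬ LexLT x a a' := by
    intro a a' haj' h h' hlt
    have h1 := (lexLT_of_gap_ne h).2
    have h2 := (lexLT_of_gap_ne h').1.le
    have h3 : gapExcept x j a ≤ ENNReal.ofReal (x a' - x a) :=
      (iInf_le _ a').trans (by rw [if_pos ⟨haj', hlt⟩])
    exact absurd (h3.trans (ENNReal.ofReal_le_ofReal (by linarith))) (not_le.2 h1)
  by_contra hne
  rcases lexLT_or_lexLT x (Ne.symm hne) with hl | hl
  · exact key haj h' h hl
  · have hnot := key haj' h h'
    exact hnot hl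

/-- Changing one entry of a dataset affects the gaps of at most three entries. -/
theorem exists_gap_eq {x x' : Fin n → ℝ} {j : Fin n} (h : ∀ i, i ≠ j → x i = x' i) :
    ∃ a₁ a₂ : Fin n, ∀ a, a ≠ j → a ≠ a₁ → a ≠ a₂ → gap x a = gap x' a := by
  have key : ∀ x : Fin n → ℝ, ∃ a₁ : Fin n, ∀ a, a ≠ j → a ≠ a₁ → gap x a = gapExcept x j a := by
    intro x
    by_cases hx : ∃ a, a ≠ j ∧ gap x a ≠ gapExcept x j a
    · obtain ⟨a₁, h1, h2⟩ := hx
      refine ⟨a₁, fun a haj ha => ?_⟩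
      by_contra hne
      exact ha (eq_of_gap_ne haj h1 hne h2)
    · push Not at hx
      -- If no entry is affected, `j` serves as a default, being excluded anyway.
      exact ⟨j, fun a haj _ => hx a haj⟩
  obtain ⟨a₁, h1⟩ := key x
  obtain ⟨a₂, h2⟩ := key x'
  refine ⟨a₁, a₂, fun a haj ha₁ ha₂ => ?_⟩
  rw [h1 a haj ha₁, h2 a haj ha₂, gapExcept_congr h haj]

/-- The bin of an entry with value `y` and gap `g`: the scale of the gap, and the location of the
value with respect to that scale. -/
noncomputable def binOf (M : ℕ) (y g : ℝ) : ℤ × ℤ :=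
  (⌊Real.logb M g⌋, ⌊y / (M : ℝ) ^ (⌊Real.logb M g⌋ + 4)⌋)

/-- The bins of the entries of a dataset. -/
noncomputable def bins (M : ℕ) (x : Fin n → ℝ) (a : Fin n) : ℤ × ℤ := binOf M (x a) (gap x a).toReal

theorem measurable_bins (M : ℕ) : Measurable fun x : Fin n → ℝ => bins M x := by
  refine measurable_pi_lambda _ fun a => ?_
  have h1 : Measurable fun x : Fin n → ℝ => ⌊Real.logb M (gap x a).toReal⌋ :=
    Int.measurable_floor.comp
      ((Real.measurable_log.comp (measurable_gap a).ennreal_toReal).div_const _)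
  have h2 : Measurable fun x : Fin n → ℝ =>
      (M : ℝ) ^ (⌊Real.logb M (gap x a).toReal⌋ + 4) :=
    (measurable_from_top (f := fun j : ℤ => (M : ℝ) ^ (j + 4))).comp h1
  exact h1.prodMk (Int.measurable_floor.comp ((measurable_pi_apply a).div h2))

/-- Private release of all heavy bins of a dataset. -/
theorem exists_release (n M : ℕ) {T : ℕ} {ε δ : ℝ} (hε : 0 < ε) (hε1 : ε ≤ 1) (hδ : 0 < δ)
    (hT : 24 * Real.log (1 + 36 / δ) / ε ≤ T) :
    ∃ κ : Kernel (Fin n → ℝ) (Finset (ℤ × ℤ)), IsMarkovKernel κ ∧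
      (∀ x x', Neighboring x x' → Indist ε δ (κ x') (κ x)) ∧
      ∀ x, ∀ᵐ Y ∂(κ x), Y.card ≤ n ∧ ∀ b, T ≤ binCount (bins M x) b → b ∈ Y := by
  have hT0 : 0 < T := by
    have hlog : 0 < Real.log (1 + 36 / δ) :=
      Real.log_pos (by linarith [div_pos (by norm_num : (0 : ℝ) < 36) hδ])
    have : (0 : ℝ) < T := lt_of_lt_of_le (by positivity) hT
    exact_mod_cast this
  let κ₀ : Kernel (Fin n → ℤ × ℤ) (Finset (ℤ × ℤ)) :=
    ⟨fun β => releaseLaw (ε / 12) T β, Measurable.of_discrete⟩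
  have happ : ∀ x, κ₀.comap (bins M) (measurable_bins M) x = releaseLaw (ε / 12) T (bins M x) :=
    fun _ => rfl
  refine ⟨κ₀.comap (bins M) (measurable_bins M), ⟨fun x => ?_⟩, ?_, fun x => ?_⟩
  · rw [happ]
    exact isProbabilityMeasure_releaseLaw (by positivity) T _
  · rintro x x' ⟨j, hj⟩
    obtain ⟨a₁, a₂, ha⟩ := exists_gap_eq hj
    rw [happ, happ]
    refine indist_releaseLaw hε hε1 hδ hT (a₁ := j) (a₂ := a₁) (a₃ := a₂) fun a h1 h2 h3 => ?_
    simp only [bins, ha a h1 h2 h3, hj a h1]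
  · rw [happ]
    exact ae_releaseLaw (by positivity) hT0 _

end Gaps

/-! ### Bins of well spread samples -/

theorem floor_eq_or_eq_add_one {s t : ℝ} (h1 : s ≤ t) (h2 : t ≤ s + 1) :
    ∃ c : Fin 2, ⌊t⌋ = ⌊s⌋ + (c : ℕ) := by
  have h3 := Int.floor_le_floor h1
  have h4 := Int.floor_le_floor h2
  rw [Int.floor_add_one] at h4
  rcases h3.eq_or_lt with h | h
  · exact ⟨0, by simp [h]⟩
  · exact ⟨1, by simp; omega⟩

/-- The bounds on the gap differ by the factor 3200 n³ ≤ M, so its logarithm to base M stays in an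
interval of length one and the floor takes at most two values. The positions fill an interval of
length 80nσ, at most one cell M^(j+4), so again there are two values. Conversely the gap pins σ
between M^(j-1) and M^(j+2). -/
theorem binOf_spec {n M : ℕ} (hn : 0 < n) (hM : 10000 * n ^ 3 ≤ M) {y g μ σ : ℝ} (hσ : 0 < σ)
    (hg1 : σ / (40 * n ^ 2) ≤ g) (hg2 : g ≤ 80 * n * σ) (hy : |y - μ| ≤ 40 * n * σ) :
    (∃ c d : Fin 2, binOf M y g = (⌊Real.logb M (σ / (40 * n ^ 2))⌋ + (c : ℕ),
      ⌊(μ - 40 * n * σ) / (M : ℝ) ^ (⌊Real.logb M (σ / (40 * n ^ 2))⌋ + (c : ℕ) + 4)⌋ + (d : ℕ))) ∧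
    ∀ v : ℝ≥0, (v : ℝ) = σ ^ 2 → Located M (binOf M y g) μ v := by
  have hn1 : (1 : ℝ) ≤ n := by exact_mod_cast hn
  have hM' : 10000 * (n : ℝ) ^ 3 ≤ M := by exact_mod_cast hM
  have hn2 : (n : ℝ) ≤ (n : ℝ) ^ 2 := by nlinarith
  have hn3 : (n : ℝ) ^ 2 ≤ (n : ℝ) ^ 3 := by nlinarith [sq_nonneg (n : ℝ)]
  have hM1 : (1 : ℝ) < M := by linarith
  have hM0 : (0 : ℝ) < M := by linarith
  have hlow : 0 < σ / (40 * n ^ 2) := by positivity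
  have hg0 : 0 < g := hlow.trans_le hg1
  set j := ⌊Real.logb M g⌋ with hj
  have hj1 : (M : ℝ) ^ j ≤ g := by
    rw [← Real.rpow_intCast, ← Real.le_logb_iff_rpow_le hM1 hg0]
    exact Int.floor_le _
  have hj2 : g < (M : ℝ) ^ (j + 1) := by
    rw [← Real.rpow_intCast, ← Real.logb_lt_iff_lt_rpow hM1 hg0]
    push_cast
    exact Int.lt_floor_add_one _
  set u := (M : ℝ) ^ (j - 1) with hu
  have hu0 : 0 < u := zpow_pos hM0 _
  have e0 : (M : ℝ) ^ j = u * M := by rw [hu, zpow_sub_one₀ hM0.ne']; field_simp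
  have e1 : (M : ℝ) ^ (j + 1) = u * M ^ 2 := by rw [zpow_add_one₀ hM0.ne', e0]; ring
  have e2 : (M : ℝ) ^ (j + 2) = u * M ^ 3 := by
    rw [show j + 2 = (j + 1) + 1 by ring, zpow_add_one₀ hM0.ne', e1]; ring
  have e4 : (M : ℝ) ^ (j + 4) = u * M ^ 5 := by
    rw [show j + 4 = ((j + 2) + 1) + 1 by ring, zpow_add_one₀ hM0.ne', zpow_add_one₀ hM0.ne', e2]
    ring
  rw [div_le_iff₀ (by positivity)] at hg1
  have hσ1 : u ≤ σ := by
    have h1 : u * M ≤ σ * M := by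
      rw [← e0]
      nlinarith
    exact le_of_mul_le_mul_right h1 hM0
  have hσ2 : σ ≤ u * M ^ 3 := by
    have h1 : g * (40 * n ^ 2) ≤ (u * M ^ 2) * M := by
      rw [← e1]
      exact mul_le_mul hj2.le (by linarith) (by positivity) (by positivity)
    linarith
  have hw : 80 * n * σ ≤ u * M ^ 5 := by
    have h1 : 80 * n * σ ≤ M * (u * M ^ 3) :=
      mul_le_mul (by linarith) hσ2 hσ.le hM0.le
    have h2 : M * (u * M ^ 3) ≤ u * M ^ 5 := by
      have : M * (u * (M : ℝ) ^ 3) * 1 ≤ M * (u * (M : ℝ) ^ 3) * M :=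
        mul_le_mul_of_nonneg_left hM1.le (by positivity)
      nlinarith
    exact h1.trans h2
  have hw0 : 0 < u * (M : ℝ) ^ 5 := by positivity
  rw [abs_le] at hy
  constructor
  · obtain ⟨c, hc⟩ : ∃ c : Fin 2, ⌊Real.logb M g⌋ = ⌊Real.logb M (σ / (40 * n ^ 2))⌋ + (c : ℕ) := by
      refine floor_eq_or_eq_add_one ?_ ?_
      · refine (Real.logb_le_logb hM1 hlow hg0).2 ?_
        rw [div_le_iff₀ (by positivity)]; exact hg1
      · rw [← Real.logb_self_eq_one hM1, ← Real.logb_mul hlow.ne' hM0.ne']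
        refine (Real.logb_le_logb hM1 hg0 (by positivity)).2 (hg2.trans ?_)
        rw [div_mul_eq_mul_div, le_div_iff₀ (by positivity)]
        have : 3200 * (n : ℝ) ^ 3 * σ ≤ M * σ := by
          gcongr; nlinarith [pow_pos (zero_lt_one.trans_le hn1) 3]
        nlinarith
    obtain ⟨d, hd⟩ : ∃ d : Fin 2,
        ⌊y / (u * M ^ 5)⌋ = ⌊(μ - 40 * n * σ) / (u * M ^ 5)⌋ + (d : ℕ) := by
      refine floor_eq_or_eq_add_one ?_ ?_
      · gcongr; linarith
      · rw [div_add_one hw0.ne']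
        gcongr
        linarith
    refine ⟨c, d, ?_⟩
    rw [← hc, ← hj, e4, ← hd, binOf, ← hj, e4]
  · intro v hv
    have hb1 : (binOf M y g).1 = j := rfl
    have hb2 : (binOf M y g).2 = ⌊y / (u * M ^ 5)⌋ := by rw [binOf, ← hj, e4]
    refine ⟨?_, ?_, ?_⟩
    · rw [hb1, hv]
      gcongr
    · rw [hb1, hv, e2]
      gcongr
    · rw [hb1, hb2, e4]
      have h1 := Int.floor_le (y / (u * M ^ 5))
      have h2 := Int.lt_floor_add_one (y / (u * M ^ 5))
      rw [le_div_iff₀ hw0] at h1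
      rw [div_lt_iff₀ hw0, add_mul, one_mul] at h2
      have h3 : 0 ≤ n * σ := by positivity
      rw [abs_le]
      constructor <;> linarith

/-- If many entries of a dataset are spread out at scale `σ` around `μ`, then some heavy bin
locates `(μ, σ ^ 2)`. -/
theorem exists_located_bin {n M T : ℕ} (hn : 0 < n) (hM : 10000 * n ^ 3 ≤ M) (hT : 0 < T)
    {x : Fin n → ℝ} {A : Finset (Fin n)} {μ σ : ℝ} {v : ℝ≥0} (hσ : 0 < σ) (hv : (v : ℝ) = σ ^ 2)
    (hA : 4 * T + 1 ≤ A.card) (h1 : ∀ a ∈ A, ∀ b, b ≠ a → σ / (40 * n ^ 2) ≤ |x a - x b|)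
    (h2 : ∀ a ∈ A, |x a - μ| ≤ 40 * n * σ) :
    ∃ b, T ≤ binCount (bins M x) b ∧ Located M b μ v := by
  classical
  have hn0 : (0 : ℝ) < n := by exact_mod_cast hn
  have hlow : 0 < σ / (40 * n ^ 2) := by positivity
  -- The largest entry of `A` is dropped: nothing bounds its gap from above. For every other entry,
  -- `m` is a successor at distance at most 80nσ.
  obtain ⟨m, hmA, hm⟩ := A.exists_max_image x (Finset.card_pos.1 (by omega))
  have hspec : ∀ a ∈ A.erase m, σ / (40 * n ^ 2) ≤ (gap x a).toReal ∧
      (gap x a).toReal ≤ 80 * n * σ := by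
    intro a ha
    obtain ⟨ham, haA⟩ := Finset.mem_erase.1 ha
    have hlt : x a < x m := by
      refine lt_of_le_of_ne (hm a haA) fun h => ?_
      have := h1 a haA m (Ne.symm ham)
      rw [h, sub_self, abs_zero] at this
      linarith
    have hup := gap_le (Or.inl hlt : LexLT x a m)
    have hlo : ENNReal.ofReal (σ / (40 * n ^ 2)) ≤ gap x a := by
      refine le_iInf fun b => ?_
      split_ifs with hb
      · refine ENNReal.ofReal_le_ofReal ?_
        have hba : b ≠ a := by
          rintro rfl
          rcases hb with hb | hb
          · exact lt_irrefl _ hb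
          · exact lt_irrefl _ hb.2
        have := h1 a haA b hba
        rwa [abs_sub_comm, abs_of_nonneg (sub_nonneg.2 hb.le)] at this
      · exact le_top
    have htop : gap x a ≠ ⊤ := ne_top_of_le_ne_top ENNReal.ofReal_ne_top hup
    constructor
    · exact (ENNReal.ofReal_le_iff_le_toReal htop).1 hlo
    · refine (ENNReal.toReal_le_of_le_ofReal (by linarith) hup).trans ?_
      have h3 := abs_le.1 (h2 a haA)
      have h4 := abs_le.1 (h2 m hmA)
      linarith
  have hb : ∀ a ∈ A.erase m, _ := fun a ha => binOf_spec (y := x a) hn hM hσ (hspec a ha).1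
    (hspec a ha).2 (h2 a (Finset.mem_of_mem_erase ha))
  set t : Finset (ℤ × ℤ) := (Finset.univ : Finset (Fin 2 × Fin 2)).image fun p =>
    (⌊Real.logb M (σ / (40 * n ^ 2))⌋ + (p.1 : ℕ),
      ⌊(μ - 40 * n * σ) / (M : ℝ) ^ (⌊Real.logb M (σ / (40 * n ^ 2))⌋ + (p.1 : ℕ) + 4)⌋ + (p.2 : ℕ))
    with ht
  have htc : t.card ≤ 4 := Finset.card_image_le.trans (by simp)
  have hmap : ∀ a ∈ A.erase m, bins M x a ∈ t := by
    intro a ha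
    obtain ⟨⟨c, d, hcd⟩, -⟩ := hb a ha
    exact Finset.mem_image.2 ⟨(c, d), Finset.mem_univ _, hcd.symm⟩
  have hcard : t.card * T ≤ (A.erase m).card := by
    rw [Finset.card_erase_of_mem hmA]
    have := Nat.mul_le_mul_right T htc
    omega
  -- Pigeonhole: at least 4T remaining entries in at most four bins.
  obtain ⟨b, -, hbT⟩ := Finset.exists_le_card_fiber_of_mul_le_card_of_maps_to hmap
    (Finset.image_nonempty.2 Finset.univ_nonempty) hcard
  refine ⟨b, hbT.trans (Finset.card_le_card (Finset.filter_subset_filter _ (Finset.subset_univ _))),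
    ?_⟩
  obtain ⟨a, ha⟩ := Finset.card_pos.1 (hT.trans_le hbT)
  obtain ⟨ha, hab⟩ := Finset.mem_filter.1 ha
  rw [← hab]
  exact (hb a ha).2 v hv

/-! ### Probabilities of the deviations -/

/-- The Chernoff bound at parameter -1. Its exponent is linear in the expected count, whereas
Hoeffding's is quadratic in P(S) and would require about K² samples to see a component of weight
1/K. -/
theorem measure_empCount_le_le {X : Type*} [MeasurableSpace X] {n : ℕ} (P : Measure X)
    [IsProbabilityMeasure P] {S : Set X} (hS : MeasurableSet S) (m : ℝ) :
    (Measure.pi fun _ : Fin n => P).real {x | empCount x S ≤ m}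
      ≤ Real.exp (m - n * P.real S / 2) := by
  set f : X → ℝ := S.indicator (fun _ => (1 : ℝ)) with hf
  have hfm : Measurable f := measurable_const.indicator hS
  have hexp : ∀ y, Real.exp (-1 * f y) = 1 - (1 - Real.exp (-1)) * f y := by
    intro y
    by_cases hy : y ∈ S <;> simp [hf, hy]
  have hfi : Integrable f P := (integrable_const 1).indicator hS
  have h_int : ∫ y, Real.exp (-1 * f y) ∂P ≤ Real.exp (-(P.real S / 2)) := by
    simp_rw [hexp]
    rw [integral_sub (integrable_const _) (hfi.const_mul _), integral_const_mul,
      show ∫ y, f y ∂P = P.real S from integral_indicator_one hS]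
    have h1 : Real.exp (-1) ≤ 1 / 2 := by
      rw [Real.exp_neg, inv_le_comm₀ (Real.exp_pos _) (by norm_num)]
      have := Real.add_one_le_exp (1 : ℝ)
      norm_num at this ⊢
      linarith
    have h2 := Real.add_one_le_exp (-(P.real S / 2))
    simp only [integral_const, probReal_univ, smul_eq_mul, mul_one]
    nlinarith [measureReal_nonneg (μ := P) (s := S)]
  have hnn : ∀ y, 0 ≤ Real.exp (-1 * f y) := fun y => (Real.exp_pos _).le
  have hprod : ∀ x : Fin n → X, Real.exp (-1 * empCount x S) = ∏ a, Real.exp (-1 * f (x a)) := by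
    intro x
    rw [← Real.exp_sum, ← Finset.mul_sum]
    rfl
  have hmgf : mgf (fun x : Fin n → X => empCount x S) (Measure.pi fun _ : Fin n => P) (-1)
      ≤ Real.exp (-(n * P.real S / 2)) := by
    rw [mgf]
    simp_rw [hprod]
    rw [integral_fintype_prod_eq_prod (f := fun _ y => Real.exp (-1 * f y)) (μ := fun _ => P)]
    rw [Finset.prod_const, Finset.card_univ, Fintype.card_fin]
    refine (pow_le_pow_left₀ (integral_nonneg hnn) h_int n).trans (le_of_eq ?_)
    rw [← Real.exp_nat_mul]
    congr 1
    ring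
  have hi : Integrable (fun x : Fin n → X => Real.exp (-1 * empCount x S))
      (Measure.pi fun _ : Fin n => P) := by
    refine Integrable.of_bound (C := 1)
      (((measurable_empCount hS).const_mul _).exp.aestronglyMeasurable)
      (Filter.Eventually.of_forall fun x => ?_)
    rw [Real.norm_eq_abs, abs_of_pos (Real.exp_pos _), Real.exp_le_one_iff]
    have : 0 ≤ empCount x S :=
      Finset.sum_nonneg fun a _ => Set.indicator_nonneg (fun _ _ => zero_le_one) _
    linarith
  refine (measure_le_le_exp_mul_mgf m (by norm_num : (-1 : ℝ) ≤ 0) hi).trans ?_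
  calc _ ≤ Real.exp (-(-1) * m) * Real.exp (-(n * P.real S / 2)) := by gcongr
    _ = _ := by rw [← Real.exp_add]; congr 1; ring

/-- The density is at most 1/(√(2π) σ) and the ball has length 2sσ; 2 < √(2π). -/
theorem gaussianReal_ball_le (μ y s : ℝ) {v : ℝ≥0} (hv : 0 < v) :
    gaussianReal μ v {u | |u - y| < s * √v} ≤ ENNReal.ofReal s := by
  have hv0 : (0 : ℝ) < v := hv
  have hsv : 0 < √(v : ℝ) := Real.sqrt_pos.2 hv0
  have hset : {u : ℝ | |u - y| < s * √v} = Metric.ball y (s * √v) := by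
    ext u; simp [Real.dist_eq]
  rw [hset, gaussianReal_apply _ hv.ne']
  calc ∫⁻ x in Metric.ball y (s * √v), gaussianPDF μ v x
      ≤ ∫⁻ _x in Metric.ball y (s * √v), ENNReal.ofReal (√(2 * Real.pi * v))⁻¹ := by
        refine lintegral_mono fun x => ENNReal.ofReal_le_ofReal ?_
        unfold gaussianPDFReal
        refine mul_le_of_le_one_right (by positivity) (Real.exp_le_one_iff.2 ?_)
        exact div_nonpos_of_nonpos_of_nonneg (neg_nonpos.2 (sq_nonneg _)) (by positivity)
    _ = ENNReal.ofReal ((√(2 * Real.pi * v))⁻¹ * (2 * (s * √v))) := by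
        rw [setLIntegral_const, Real.volume_ball, ← ENNReal.ofReal_mul (by positivity)]
    _ ≤ ENNReal.ofReal s := by
        rcases le_or_gt 0 s with hs | hs
        · refine ENNReal.ofReal_le_ofReal ?_
          have h2 : 2 * √(v : ℝ) ≤ √(2 * Real.pi * v) := by
            refine Real.le_sqrt_of_sq_le ?_
            rw [mul_pow, Real.sq_sqrt hv0.le]
            nlinarith [Real.pi_gt_three]
          rw [inv_mul_le_iff₀ (by positivity)]
          nlinarith
        · rw [ENNReal.ofReal_of_nonpos]
          · exact zero_le
          · exact mul_nonpos_of_nonneg_of_nonpos (by positivity) (by nlinarith)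

/-- Chebyshev suffices: with s = 40n a union bound over n samples still leaves a small probability.
-/
theorem gaussianReal_tail_le (μ : ℝ) {v : ℝ≥0} (hv : 0 < v) {s : ℝ} (hs : 0 < s) :
    gaussianReal μ v {u | s * √v ≤ |u - μ|} ≤ ENNReal.ofReal (1 / s ^ 2) := by
  have hv0 : (0 : ℝ) < v := hv
  have hsv : 0 < √(v : ℝ) := Real.sqrt_pos.2 hv0
  have h := meas_ge_le_variance_div_sq (μ := gaussianReal μ v) (X := id)
    (memLp_id_gaussianReal 2) (c := s * √v) (by positivity)
  rw [variance_id_gaussianReal] at h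
  simp only [id, integral_id_gaussianReal] at h
  refine h.trans (ENNReal.ofReal_le_ofReal (le_of_eq ?_))
  rw [mul_pow, Real.sq_sqrt hv0.le]
  field_simp

/-! ### Samples with labels -/

namespace GMM

variable {k : ℕ}

/-- The joint law of the component and of the value of a sample. -/
noncomputable def labeledLaw (D : GMM k) : Measure (Fin k × ℝ) :=
  ∑ i, ENNReal.ofReal (D.weight i) • (gaussianReal (D.mean i) (D.var i)).map (Prod.mk i)

theorem labeledLaw_apply (D : GMM k) {S : Set (Fin k × ℝ)} (hS : MeasurableSet S) :
    D.labeledLaw S = ∑ i, ENNReal.ofReal (D.weight i) *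
      gaussianReal (D.mean i) (D.var i) {u | (i, u) ∈ S} := by
  simp only [labeledLaw, Measure.finsetSum_apply, Measure.smul_apply, smul_eq_mul]
  refine Finset.sum_congr rfl fun i _ => ?_
  rw [Measure.map_apply measurable_prodMk_left hS]
  rfl

instance (D : GMM k) : IsProbabilityMeasure D.labeledLaw := by
  constructor
  rw [labeledLaw_apply D MeasurableSet.univ]
  simp only [Set.mem_univ, Set.ofPred_true, measure_univ, mul_one]
  rw [← ENNReal.ofReal_sum_of_nonneg fun i _ => D.weight_nonneg i, D.weight_sum, ENNReal.ofReal_one]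

theorem map_snd_labeledLaw (D : GMM k) : D.labeledLaw.map Prod.snd = D.law := by
  ext S hS
  rw [Measure.map_apply measurable_snd hS, labeledLaw_apply D (measurable_snd hS)]
  simp only [law, Measure.finsetSum_apply, Measure.smul_apply, smul_eq_mul]
  rfl

/-- The learner sees unlabeled samples, but its failure event can be analysed with the component
labels attached. -/
theorem pi_law_eq_map (D : GMM k) (n : ℕ) : (Measure.pi fun _ : Fin n => D.law)
    = (Measure.pi fun _ : Fin n => D.labeledLaw).map fun z a => (z a).2 := by
  have : ∀ _ : Fin n, SigmaFinite (D.labeledLaw.map Prod.snd) := fun _ => by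
    rw [map_snd_labeledLaw]; infer_instance
  rw [Measure.pi_map_pi (f := fun _ => Prod.snd) fun _ => measurable_snd.aemeasurable]
  simp only [map_snd_labeledLaw]

theorem labeledLaw_le_of_forall (D : GMM k) {S : Set (Fin k × ℝ)} (hS : MeasurableSet S) {r : ℝ≥0∞}
    (h : ∀ i, gaussianReal (D.mean i) (D.var i) {u | (i, u) ∈ S} ≤ r) : D.labeledLaw S ≤ r := by
  rw [labeledLaw_apply D hS]
  calc _ ≤ ∑ i, ENNReal.ofReal (D.weight i) * r := by gcongr with i; exact h i
    _ = r := by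
        rw [← Finset.sum_mul, ← ENNReal.ofReal_sum_of_nonneg fun i _ => D.weight_nonneg i,
          D.weight_sum, ENNReal.ofReal_one, one_mul]

theorem labeledLaw_real_label (D : GMM k) (i : Fin k) :
    D.labeledLaw.real {u | u.1 = i} = D.weight i := by
  have hS : MeasurableSet {u : Fin k × ℝ | u.1 = i} := measurable_fst (measurableSet_singleton i)
  rw [measureReal_def, labeledLaw_apply D hS, Finset.sum_eq_single i]
  · simp [D.weight_nonneg i]
  · intro j _ hj
    simp [hj]
  · simp

variable {n : ℕ}

/-- Fix the second sample. Whatever component produced the first, its anticoncentration is at its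
own scale, which is the scale in the event; the component of the second sample plays no role. -/
theorem measure_close_le (D : GMM k) {a b : Fin n} (hab : a ≠ b) (s : ℝ) :
    (Measure.pi fun _ : Fin n => D.labeledLaw)
      {z | |(z a).2 - (z b).2| < s * √(D.var (z a).1)} ≤ ENNReal.ofReal s := by
  have hind : IndepFun (fun z : Fin n → Fin k × ℝ => z a) (fun z => z b)
      (Measure.pi fun _ : Fin n => D.labeledLaw) :=
    (iIndepFun_pi (X := fun (_ : Fin n) (u : Fin k × ℝ) => u) (μ := fun _ : Fin n => D.labeledLaw)
      fun _ => measurable_id.aemeasurable).indepFun hab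
  have hmap : ∀ a : Fin n, (Measure.pi fun _ : Fin n => D.labeledLaw).map (fun z => z a)
      = D.labeledLaw := fun a => (measurePreserving_eval (fun _ : Fin n => D.labeledLaw) a).map_eq
  have hprod := (indepFun_iff_map_prod_eq_prod_map_map (measurable_pi_apply a).aemeasurable
    (measurable_pi_apply b).aemeasurable).1 hind
  rw [hmap, hmap] at hprod
  set S : Set ((Fin k × ℝ) × (Fin k × ℝ)) := {p | |p.1.2 - p.2.2| < s * √(D.var p.1.1)} with hS
  have hσ : Measurable fun p : (Fin k × ℝ) × (Fin k × ℝ) => s * √(D.var p.1.1 : ℝ) :=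
    (Measurable.of_discrete (f := fun i : Fin k => s * √(D.var i : ℝ))).comp
      (measurable_fst.comp measurable_fst)
  have hSm : MeasurableSet S := measurableSet_lt (_root_.continuous_abs.measurable.comp
    ((measurable_snd.comp measurable_fst).sub (measurable_snd.comp measurable_snd))) hσ
  have hpre : {z : Fin n → Fin k × ℝ | |(z a).2 - (z b).2| < s * √(D.var (z a).1)}
      = (fun z => (z a, z b)) ⁻¹' S := rfl
  rw [hpre, ← Measure.map_apply ((measurable_pi_apply a).prodMk (measurable_pi_apply b)) hSm, hprod,
    Measure.prod_apply_symm hSm]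
  calc _ ≤ ∫⁻ _y, ENNReal.ofReal s ∂D.labeledLaw := by
        refine lintegral_mono fun y => ?_
        refine D.labeledLaw_le_of_forall (measurable_prodMk_right hSm) fun i => ?_
        exact gaussianReal_ball_le _ y.2 s (D.var_pos i)
    _ = _ := by simp

theorem measure_far_le (D : GMM k) (a : Fin n) {s : ℝ} (hs : 0 < s) :
    (Measure.pi fun _ : Fin n => D.labeledLaw)
      {z | s * √(D.var (z a).1) ≤ |(z a).2 - D.mean (z a).1|} ≤ ENNReal.ofReal (1 / s ^ 2) := by
  set S : Set (Fin k × ℝ) := {u | s * √(D.var u.1) ≤ |u.2 - D.mean u.1|} with hS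
  have hSm : MeasurableSet S := by
    refine measurableSet_le ?_ (_root_.continuous_abs.measurable.comp (measurable_snd.sub ?_))
    · exact (Measurable.of_discrete (f := fun i : Fin k => s * √(D.var i : ℝ))).comp measurable_fst
    · exact (Measurable.of_discrete (f := fun i : Fin k => D.mean i)).comp measurable_fst
  have hpre : {z : Fin n → Fin k × ℝ | s * √(D.var (z a).1) ≤ |(z a).2 - D.mean (z a).1|}
      = Function.eval a ⁻¹' S := rfl
  rw [hpre, (measurePreserving_eval (fun _ : Fin n => D.labeledLaw) a).measure_preimage
    hSm.nullMeasurableSet]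
  exact D.labeledLaw_le_of_forall hSm fun i => gaussianReal_tail_le _ (D.var_pos i) hs

/-- With high probability, every heavy component is located by a heavy bin. -/
theorem measure_not_located_le (D : GMM k) (hk : 0 < k) {K M T : ℕ} (hK : 0 < K) (hn : 0 < n)
    (hM : 10000 * n ^ 3 ≤ M) (hT : 0 < T) (hnT : 2 * K * (4 * T + Real.log (40 * k)) ≤ n) :
    (Measure.pi fun _ : Fin n => D.law) {x | ¬ ∀ i, 1 / (K : ℝ) ≤ D.weight i →
      ∃ b, T ≤ binCount (bins M x) b ∧ Located M b (D.mean i) (D.var i)} ≤ 3 / 40 := by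
  have hn1 : (1 : ℝ) ≤ n := by exact_mod_cast hn
  have hn0 : (0 : ℝ) < n := by linarith
  have hK0 : (0 : ℝ) < K := by exact_mod_cast hK
  have hk0 : (0 : ℝ) < k := by exact_mod_cast hk
  set P := Measure.pi fun _ : Fin n => D.labeledLaw with hP
  -- The failure events, each of probability at most 1/40: two samples too close, a sample too far
  -- from its mean, a heavy component with at most 4T samples.
  set E₁ : Set (Fin n → Fin k × ℝ) := ⋃ p : {p : Fin n × Fin n // p.1 ≠ p.2},
    {z | |(z p.1.1).2 - (z p.1.2).2| < 1 / (40 * n ^ 2) * √(D.var (z p.1.1).1)} with hE₁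
  set E₂ : Set (Fin n → Fin k × ℝ) := ⋃ a : Fin n,
    {z | 40 * n * √(D.var (z a).1) ≤ |(z a).2 - D.mean (z a).1|} with hE₂
  set E₃ : Set (Fin n → Fin k × ℝ) := ⋃ i : {i : Fin k // 1 / (K : ℝ) ≤ D.weight i},
    {z | empCount z {u | u.1 = i.1} ≤ (4 * T : ℝ)} with hE₃
  have hP₁ : P E₁ ≤ 1 / 40 := by
    calc P E₁ ≤ ∑ _p : {p : Fin n × Fin n // p.1 ≠ p.2}, ENNReal.ofReal (1 / (40 * n ^ 2)) :=
          (measure_iUnion_fintype_le _ _).trans (Finset.sum_le_sum fun p _ =>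
            D.measure_close_le p.2 _)
      _ ≤ ENNReal.ofReal (1 / 40) := by
          rw [Finset.sum_const, nsmul_eq_mul, ← ENNReal.ofReal_natCast,
            ← ENNReal.ofReal_mul (Nat.cast_nonneg _)]
          refine ENNReal.ofReal_le_ofReal ?_
          have : ((Finset.univ : Finset {p : Fin n × Fin n // p.1 ≠ p.2}).card : ℝ) ≤ n ^ 2 := by
            rw [Finset.card_univ]
            have := Fintype.card_subtype_le (fun p : Fin n × Fin n => p.1 ≠ p.2)
            rw [Fintype.card_prod, Fintype.card_fin, ← sq] at this
            exact_mod_cast this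
          calc _ ≤ (n : ℝ) ^ 2 * (1 / (40 * n ^ 2)) := by gcongr
            _ = _ := by field_simp
      _ = 1 / 40 := by rw [ENNReal.ofReal_div_of_pos (by norm_num)]; simp
  have hP₂ : P E₂ ≤ 1 / 40 := by
    calc P E₂ ≤ ∑ _a : Fin n, ENNReal.ofReal (1 / (40 * n) ^ 2) :=
          (measure_iUnion_fintype_le _ _).trans (Finset.sum_le_sum fun a _ =>
            D.measure_far_le a (by positivity))
      _ ≤ ENNReal.ofReal (1 / 40) := by
          rw [Finset.sum_const, nsmul_eq_mul, ← ENNReal.ofReal_natCast,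
            ← ENNReal.ofReal_mul (Nat.cast_nonneg _)]
          refine ENNReal.ofReal_le_ofReal ?_
          rw [Finset.card_univ, Fintype.card_fin, mul_one_div, div_le_div_iff₀ (by positivity)
            (by norm_num)]
          nlinarith
      _ = 1 / 40 := by rw [ENNReal.ofReal_div_of_pos (by norm_num)]; simp
  have hP₃ : P E₃ ≤ 1 / 40 := by
    calc P E₃ ≤ ∑ _i : {i : Fin k // 1 / (K : ℝ) ≤ D.weight i}, ENNReal.ofReal (1 / (40 * k)) := by
          refine (measure_iUnion_fintype_le _ _).trans (Finset.sum_le_sum fun i _ => ?_)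
          rw [← ofReal_measureReal]
          refine ENNReal.ofReal_le_ofReal ?_
          have hS : MeasurableSet {u : Fin k × ℝ | u.1 = i.1} :=
            measurable_fst (measurableSet_singleton i.1)
          refine (measure_empCount_le_le D.labeledLaw hS _).trans ?_
          rw [labeledLaw_real_label]
          have h1 : (4 * T : ℝ) - n * D.weight i / 2 ≤ -Real.log (40 * k) := by
            have h2 := i.2
            rw [div_le_iff₀ hK0] at h2
            have h3 : 2 * K * (4 * T + Real.log (40 * k)) ≤ K * (n * D.weight i) := by nlinarith
            have h4 := le_of_mul_le_mul_left
              (by linarith : (K : ℝ) * (2 * (4 * T + Real.log (40 * k))) ≤ K * (n * D.weight i)) hK0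
            linarith
          refine (Real.exp_le_exp.2 h1).trans (le_of_eq ?_)
          rw [Real.exp_neg, Real.exp_log (by positivity), one_div]
      _ ≤ ENNReal.ofReal (1 / 40) := by
          rw [Finset.sum_const, nsmul_eq_mul, ← ENNReal.ofReal_natCast,
            ← ENNReal.ofReal_mul (Nat.cast_nonneg _)]
          refine ENNReal.ofReal_le_ofReal ?_
          have : ((Finset.univ : Finset {i : Fin k // 1 / (K : ℝ) ≤ D.weight i}).card : ℝ) ≤ k := by
            rw [Finset.card_univ]
            have := Fintype.card_subtype_le (fun i : Fin k => 1 / (K : ℝ) ≤ D.weight i)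
            rw [Fintype.card_fin] at this
            exact_mod_cast this
          calc _ ≤ (k : ℝ) * (1 / (40 * k)) := by gcongr
            _ = _ := by field_simp
      _ = 1 / 40 := by rw [ENNReal.ofReal_div_of_pos (by norm_num)]; simp
  set Bad : Set (Fin n → ℝ) := {x | ¬ ∀ i, 1 / (K : ℝ) ≤ D.weight i →
      ∃ b, T ≤ binCount (bins M x) b ∧ Located M b (D.mean i) (D.var i)} with hBad
  have hBadm : MeasurableSet Bad := measurable_bins M (MeasurableSet.of_discrete
    (s := {β : Fin n → ℤ × ℤ | ¬ ∀ i, 1 / (K : ℝ) ≤ D.weight i →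
      ∃ b, T ≤ binCount β b ∧ Located M b (D.mean i) (D.var i)}))
  have hmeas : Measurable fun (z : Fin n → Fin k × ℝ) a => (z a).2 :=
    measurable_pi_lambda _ fun a => measurable_snd.comp (measurable_pi_apply a)
  rw [pi_law_eq_map, Measure.map_apply hmeas hBadm]
  have hsub : (fun (z : Fin n → Fin k × ℝ) a => (z a).2) ⁻¹' Bad ⊆ E₁ ∪ E₂ ∪ E₃ := by
    intro z hz
    by_contra hcon
    simp only [Set.mem_union, not_or] at hcon
    obtain ⟨⟨hz1, hz2⟩, hz3⟩ := hcon
    refine hz fun i hi => ?_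
    have hσ : 0 < √(D.var i : ℝ) := Real.sqrt_pos.2 (by exact_mod_cast D.var_pos i)
    refine exists_located_bin (A := Finset.univ.filter fun a => (z a).1 = i) hn hM hT hσ
      (Real.sq_sqrt (NNReal.coe_nonneg _)).symm ?_ ?_ ?_
    · have h1 : ¬ empCount z {u | u.1 = i} ≤ (4 * T : ℝ) := fun h =>
        hz3 (Set.mem_iUnion.2 ⟨⟨i, hi⟩, h⟩)
      have h2 : empCount z {u | u.1 = i} =
          ((Finset.univ.filter fun a => (z a).1 = i).card : ℝ) := by
        rw [empCount, Finset.card_filter, Nat.cast_sum]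
        refine Finset.sum_congr rfl fun a _ => ?_
        by_cases ha : (z a).1 = i <;> simp [ha]
      rw [h2, not_le] at h1
      have h3 : 4 * T < (Finset.univ.filter fun a => (z a).1 = i).card := by exact_mod_cast h1
      exact h3
    · intro a ha b hb
      have ha' : (z a).1 = i := (Finset.mem_filter.1 ha).2
      by_contra! hlt
      refine hz1 (Set.mem_iUnion.2 ⟨⟨(a, b), hb.symm⟩, ?_⟩)
      change |(z a).2 - (z b).2| < 1 / (40 * n ^ 2) * √(D.var (z a).1)
      rw [ha']
      exact hlt.trans_eq (by ring)
    · intro a ha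
      have ha' : (z a).1 = i := (Finset.mem_filter.1 ha).2
      by_contra! hlt
      refine hz2 (Set.mem_iUnion.2 ⟨a, ?_⟩)
      change 40 * n * √(D.var (z a).1) ≤ |(z a).2 - D.mean (z a).1|
      rw [ha']
      exact hlt.le
  calc _ ≤ P (E₁ ∪ E₂ ∪ E₃) := measure_mono hsub
    _ ≤ P E₁ + P E₂ + P E₃ := (measure_union_le _ _).trans (by gcongr; exact measure_union_le _ _)
    _ ≤ 1 / 40 + 1 / 40 + 1 / 40 := by gcongr
    _ = 3 / 40 := by rw [← ENNReal.add_div, ← ENNReal.add_div]; norm_num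

end GMM

/-! ### The two-stage learner -/

section Split

variable {X : Type*} [MeasurableSpace X] {n₁ n₂ : ℕ}

/-- Split a dataset into its first `n₁` and its last `n₂` entries. -/
def splitData (x : Fin (n₁ + n₂) → X) : (Fin n₁ → X) × (Fin n₂ → X) :=
  (fun i => x (Fin.castAdd n₂ i), fun i => x (Fin.natAdd n₁ i))

theorem measurable_splitData : Measurable (splitData (X := X) (n₁ := n₁) (n₂ := n₂)) :=
  (measurable_pi_lambda _ fun _ => measurable_pi_apply _).prodMk
    (measurable_pi_lambda _ fun _ => measurable_pi_apply _)

theorem map_splitData (P : Measure X) [IsProbabilityMeasure P] :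
    (Measure.pi fun _ : Fin (n₁ + n₂) => P).map splitData
      = (Measure.pi fun _ : Fin n₁ => P).prod (Measure.pi fun _ : Fin n₂ => P) := by
  set app : (Fin n₁ → X) × (Fin n₂ → X) → Fin (n₁ + n₂) → X := fun p => Fin.append p.1 p.2 with happ
  have hm : Measurable app := by
    refine measurable_pi_lambda _ fun i => ?_
    refine Fin.addCases (fun i => ?_) (fun i => ?_) i
    · simp only [happ, Fin.append_left]
      exact (measurable_pi_apply i).comp measurable_fst
    · simp only [happ, Fin.append_right]
      exact (measurable_pi_apply i).comp measurable_snd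
  have hpi : (Measure.pi fun _ : Fin (n₁ + n₂) => P)
      = ((Measure.pi fun _ : Fin n₁ => P).prod (Measure.pi fun _ : Fin n₂ => P)).map app := by
    refine Measure.pi_eq fun s hs => ?_
    rw [Measure.map_apply hm (MeasurableSet.univ_pi hs)]
    have : app ⁻¹' (Set.univ.pi s) = (Set.univ.pi fun i => s (Fin.castAdd n₂ i)) ×ˢ
        (Set.univ.pi fun i => s (Fin.natAdd n₁ i)) := by
      ext p
      simp only [Set.mem_preimage, Set.mem_pi, Set.mem_univ, true_imp_iff, Set.mem_prod, happ]
      constructor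
      · intro h
        exact ⟨fun i => by simpa using h (Fin.castAdd n₂ i),
          fun i => by simpa using h (Fin.natAdd n₁ i)⟩
      · rintro ⟨h1, h2⟩ i
        refine Fin.addCases (fun i => ?_) (fun i => ?_) i
        · simpa using h1 i
        · simpa using h2 i
    rw [this, Measure.prod_prod, Measure.pi_pi, Measure.pi_pi, Fin.prod_univ_add]
  have hid : splitData ∘ app = id := by
    funext p
    simp [splitData, happ]
  rw [hpi, Measure.map_map measurable_splitData hm, hid, Measure.map_id]

theorem neighboring_splitData {X : Type*} {x x' : Fin (n₁ + n₂) → X} (h : Neighboring x x') :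
    (Neighboring (splitData x).1 (splitData x').1 ∧ (splitData x).2 = (splitData x').2) ∨
    ((splitData x).1 = (splitData x').1 ∧ Neighboring (splitData x).2 (splitData x').2) := by
  obtain ⟨j, hj⟩ := h
  induction j using Fin.addCases with
  | left j =>
    refine Or.inl ⟨⟨j, fun i hi => hj _ fun h => hi (Fin.castAdd_injective _ _ h)⟩, ?_⟩
    funext i
    exact hj _ fun h => by simp [Fin.ext_iff] at h; omega
  | right j =>
    refine Or.inr ⟨?_, ⟨j, fun i hi => hj _ fun h => hi (Fin.natAdd_injective _ _ h)⟩⟩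
    funext i
    exact hj _ fun h => by simp [Fin.ext_iff] at h; omega

end Split

theorem GMM.exists_heavy {k K : ℕ} (hk : 0 < k) (hK : k ≤ K) (D : GMM k) :
    ∃ i, 1 / (K : ℝ) ≤ D.weight i := by
  obtain ⟨a, ha, haw⟩ := exists_rounding hk hK D.weight D.weight_nonneg D.weight_sum
  obtain ⟨i, -, hi⟩ : ∃ i ∈ Finset.univ, 0 < a i :=
    Finset.sum_pos_iff.1 (by omega)
  exact ⟨i, (haw i).2 hi⟩

theorem GMM.nonempty {k : ℕ} (hk : 0 < k) : Nonempty (GMM k) :=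
  ⟨{ weight := Pi.single ⟨0, hk⟩ 1
     mean := 0
     var := 1
     weight_nonneg := fun i => by
       by_cases h : i = ⟨0, hk⟩
       · subst h; simp
       · simp [h]
     weight_sum := by simp
     var_pos := fun _ => zero_lt_one }⟩

/-- An upper bound for the number of hypotheses that the first stage leaves. -/
def coverSize (k K M q n : ℕ) : ℕ :=
  (n * ((4 * M ^ 5 * q + 1) * (M ^ 6 * (q + 1) + 1)) * (K + 1)) ^ k

/-- Selection among the mixtures located by the bins in `Y`. -/
theorem exists_selector_of_bins {k K M q n₁ n : ℕ} {α ε : ℝ} (hk : 0 < k) (hK : k ≤ K) (hM : 0 < M)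
    (hq : 0 < q) (hα : 0 < α) (hε : 0 < ε) (hn : 0 < n) (hKq : (k : ℝ) / K + 2 / q ≤ α / 10)
    (hn1 : 20 / (α * ε) * Real.log (40 * coverSize k K M q n₁) ≤ n)
    (hn2 : 50 / α ^ 2 * Real.log (80 * (coverSize k K M q n₁ : ℝ) ^ 2) ≤ n) (Y : Finset (ℤ × ℤ)) :
    ∃ κ : Kernel (Fin n → ℝ) (GMM k), IsMarkovKernel κ ∧ IsDP κ ε 0 ∧
      (Y.card ≤ n₁ → ∀ D : GMM k,
        (∀ i, 1 / (K : ℝ) ≤ D.weight i → ∃ b ∈ Y, Located M b (D.mean i) (D.var i)) →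
        ∫⁻ x, κ x {H | α < GMM.tvDist H D} ∂(Measure.pi fun _ : Fin n => D.law) ≤ 1 / 20) := by
  by_cases hY : Y.Nonempty ∧ Y.card ≤ n₁
  · obtain ⟨ι, _, _, h, hcard, hcov⟩ := exists_cover hk hK hM hq hY.1
    have hN : 0 < Fintype.card ι := Fintype.card_pos
    have hN0 : (0 : ℝ) < Fintype.card ι := by exact_mod_cast hN
    have hle : (Fintype.card ι : ℝ) ≤ coverSize k K M q n₁ := by
      have : Fintype.card ι ≤ coverSize k K M q n₁ := by
        refine hcard.trans ?_
        unfold coverSize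
        gcongr
        exact hY.2
      exact_mod_cast this
    obtain ⟨κ, h1, h2, h3⟩ := exists_selector h hα hε hn
      (le_trans (by gcongr) hn1) (le_trans (by gcongr) hn2)
    refine ⟨κ, h1, h2, fun _ D hD => h3 D ?_⟩
    obtain ⟨i, hi⟩ := hcov D hD
    exact ⟨i, hi.trans hKq⟩
  -- Privacy is required for every `Y`, accuracy only when `Y` locates the heavy components. Some
  -- component is always heavy, so an empty `Y` never counts, and a constant output is harmless
  -- here.
  · obtain ⟨H⟩ := GMM.nonempty hk
    refine ⟨Kernel.const _ (Measure.dirac H), inferInstance, ?_, fun hc D hD => ?_⟩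
    · intro x x' _ S _
      simp only [Kernel.const_apply, ENNReal.ofReal_zero, add_zero]
      exact le_mul_of_one_le_left zero_le (ENNReal.one_le_ofReal.2 (Real.one_le_exp hε.le))
    · exfalso
      obtain ⟨i, hi⟩ := D.exists_heavy hk hK
      obtain ⟨b, hb, -⟩ := hD i hi
      exact hY ⟨⟨b, hb⟩, hc⟩

/-- The two-stage learner: bins released from the first part of the data determine a finite list of
hypotheses, from which the second part of the data selects. -/
theorem exists_learner {k K M q T n₁ n₂ : ℕ} {α ε δ : ℝ} (hk : 0 < k) (hK : k ≤ K)
    (hM : 10000 * n₁ ^ 3 ≤ M) (hq : 0 < q) (hα : 0 < α) (hε : 0 < ε) (hε1 : ε ≤ 1)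
    (hδ : 0 < δ) (hn₁ : 0 < n₁) (hn₂ : 0 < n₂) (hKq : (k : ℝ) / K + 2 / q ≤ α / 10)
    (hT0 : 0 < T) (hT : 24 * Real.log (1 + 36 / δ) / ε ≤ T)
    (hnT : 2 * K * (4 * T + Real.log (40 * k)) ≤ n₁)
    (h1 : 20 / (α * ε) * Real.log (40 * coverSize k K M q n₁) ≤ n₂)
    (h2 : 50 / α ^ 2 * Real.log (80 * (coverSize k K M q n₁ : ℝ) ^ 2) ≤ n₂) :
    ∃ A : Kernel (Fin (n₁ + n₂) → ℝ) (GMM k), IsMarkovKernel A ∧ IsDP A ε δ ∧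
      ∀ D : GMM k, ((Measure.pi fun _ : Fin (n₁ + n₂) => D.law).bind A)
        {H | α < GMM.tvDist H D} ≤ 1 / 8 := by
  have hM0 : 0 < M := lt_of_lt_of_le (by positivity) hM
  obtain ⟨κ₁, hκ₁, hdp₁, hacc₁⟩ := exists_release n₁ M hε hε1 hδ hT
  choose κ hκ hdp hacc using exists_selector_of_bins hk hK hM0 hq hα hε hn₂ hKq h1 h2
  let κ₂ : Kernel (Finset (ℤ × ℤ) × (Fin n₂ → ℝ)) (GMM k) :=
    ⟨fun p => κ p.1 p.2, measurable_from_prod_countable_right fun Y => (κ Y).measurable⟩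
  have hκ₂ : IsMarkovKernel κ₂ := ⟨fun p => (hκ p.1).isProbabilityMeasure p.2⟩
  let A₀ : Kernel ((Fin n₁ → ℝ) × (Fin n₂ → ℝ)) (GMM k) := κ₂ ∘ₖ (κ₁ ∥ₖ Kernel.id)
  have hmeas : ∀ {S : Set (GMM k)}, MeasurableSet S →
      Measurable fun p : Finset (ℤ × ℤ) × (Fin n₂ → ℝ) => κ p.1 p.2 S := fun hS =>
    κ₂.measurable_coe hS
  have hA₀ : ∀ p {S : Set (GMM k)}, MeasurableSet S →
      A₀ p S = ∫⁻ Y, κ Y p.2 S ∂(κ₁ p.1) := by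
    intro p S hS
    rw [Kernel.comp_apply' _ _ _ hS, Kernel.lintegral_parallelComp _ (κ₂.measurable_coe hS)]
    refine lintegral_congr fun Y => ?_
    rw [Kernel.id_apply]
    exact lintegral_dirac' _ ((κ₂.measurable_coe hS).comp measurable_prodMk_left)
  have hA : ∀ x {S : Set (GMM k)}, MeasurableSet S →
      A₀.comap splitData measurable_splitData x S
        = ∫⁻ Y, κ Y (splitData x).2 S ∂(κ₁ (splitData x).1) := fun x S hS => by
    rw [Kernel.comap_apply, hA₀ _ hS]
  refine ⟨A₀.comap splitData measurable_splitData, inferInstance, ?_, fun D => ?_⟩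
  · intro x x' hx S hS
    rw [hA _ hS, hA _ hS]
    -- If the changed entry is in the first part, the output probability as a function of `Y` is a
    -- [0, 1]-valued test function for `Indist`. If it is in the second part, the law of `Y` is
    -- unchanged and the privacy of each selector is averaged.
    rcases neighboring_splitData hx with ⟨hx1, hx2⟩ | ⟨hx1, hx2⟩
    · rw [← hx2]
      exact hdp₁ _ _ hx1 _ ((hmeas hS).comp measurable_prodMk_right) fun Y => prob_le_one
    · have hm : Measurable fun Y => κ Y (splitData x).2 S := (hmeas hS).comp measurable_prodMk_right
      rw [← hx1, ← lintegral_const_mul _ hm]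
      refine le_add_right (lintegral_mono fun Y => ?_)
      simpa using hdp Y _ _ hx2 S hS
  · have hS : MeasurableSet {H : GMM k | α < GMM.tvDist H D} :=
      measurableSet_lt measurable_const (GMM.measurable_tvDist D)
    set S := {H : GMM k | α < GMM.tvDist H D} with hSdef
    set P₁ := Measure.pi fun _ : Fin n₁ => D.law with hP₁
    set P₂ := Measure.pi fun _ : Fin n₂ => D.law with hP₂
    set Bad : Set (Fin n₁ → ℝ) := {x | ¬ ∀ i, 1 / (K : ℝ) ≤ D.weight i →
      ∃ b, T ≤ binCount (bins M x) b ∧ Located M b (D.mean i) (D.var i)} with hBad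
    have hBadm : MeasurableSet Bad := measurable_bins M (MeasurableSet.of_discrete
      (s := {β : Fin n₁ → ℤ × ℤ | ¬ ∀ i, 1 / (K : ℝ) ≤ D.weight i →
        ∃ b, T ≤ binCount β b ∧ Located M b (D.mean i) (D.var i)}))
    have hPB : P₁ Bad ≤ 3 / 40 := D.measure_not_located_le hk (hk.trans_le hK) hn₁ hM hT0 hnT
    have hinner : ∀ x₁, ∫⁻ x₂, A₀ (x₁, x₂) S ∂P₂ ≤ Bad.indicator 1 x₁ + 1 / 20 := by
      intro x₁
      by_cases hx : x₁ ∈ Bad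
      · rw [Set.indicator_of_mem hx]
        refine le_trans ?_ le_self_add
        calc _ ≤ ∫⁻ _x₂, 1 ∂P₂ := lintegral_mono fun x₂ => prob_le_one
          _ = 1 := by simp
      · refine le_trans ?_ le_add_self
        simp_rw [hA₀ _ hS]
        have hm : Measurable (Function.uncurry fun (x₂ : Fin n₂ → ℝ) Y => κ Y x₂ S) :=
          (hmeas hS).comp measurable_swap
        -- Given the first part, the released set is independent of the second part, so the
        -- selector's guarantee applies with `Y` held fixed.
        rw [lintegral_lintegral_swap hm.aemeasurable]
        calc _ ≤ ∫⁻ _Y, 1 / 20 ∂(κ₁ x₁) := by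
              refine lintegral_mono_ae ?_
              filter_upwards [hacc₁ x₁] with Y hY
              refine hacc Y hY.1 D fun i hi => ?_
              obtain ⟨b, hb, hl⟩ := not_not.1 hx i hi
              exact ⟨b, hY.2 b hb, hl⟩
          _ = 1 / 20 := by simp
    rw [Measure.bind_apply hS (Kernel.aemeasurable _)]
    have hsplit : ∫⁻ x, A₀.comap splitData measurable_splitData x S
        ∂(Measure.pi fun _ : Fin (n₁ + n₂) => D.law) = ∫⁻ p, A₀ p S ∂(P₁.prod P₂) := by
      rw [← map_splitData, lintegral_map (A₀.measurable_coe hS) measurable_splitData]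
      rfl
    rw [hsplit, lintegral_prod _ (A₀.measurable_coe hS).aemeasurable]
    calc _ ≤ ∫⁻ x₁, (Bad.indicator 1 x₁ + 1 / 20) ∂P₁ := lintegral_mono hinner
      _ = P₁ Bad + 1 / 20 := by
          rw [lintegral_add_right _ measurable_const, lintegral_indicator_one hBadm,
            lintegral_const, measure_univ, mul_one]
      _ ≤ 3 / 40 + 1 / 20 := by gcongr
      _ = 1 / 8 := by
          have h20 : (1 : ℝ≥0∞) / 20 = 2 / 40 := by rw [ENNReal.div_eq_div_iff] <;> norm_num
          rw [h20, ← ENNReal.add_div, ENNReal.div_eq_div_iff] <;> norm_num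

/-! ### Sample complexity -/

/-- The argument of the logarithmic factor in the sample complexity. -/
noncomputable def logArg (k : ℕ) (α ε δ : ℝ) : ℝ := 2 + k + 1 / α + 1 / ε + Real.log (1 / δ)

/-- Polynomial size is all that matters, since only the logarithm enters; 524 = 13 + 230 + 275 + 6
collects the bins, both grids and the weights. -/
theorem coverSize_le {k K M q n : ℕ} {Z : ℝ} (hZ : 5 ≤ Z) (hn : (n : ℝ) ≤ Z ^ 13)
    (hM : (M : ℝ) ≤ Z ^ 45) (hq : (q : ℝ) ≤ Z ^ 4) (hK : (K : ℝ) ≤ Z ^ 5) :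
    (coverSize k K M q n : ℝ) ≤ (Z ^ 524) ^ k := by
  have hZ1 : 1 ≤ Z := by linarith
  have h1 : 4 * (M : ℝ) ^ 5 * q + 1 ≤ Z ^ 230 := by
    have h2 : 4 * (M : ℝ) ^ 5 * q ≤ 4 * (Z ^ 45) ^ 5 * Z ^ 4 := by gcongr
    have h3 : (1 : ℝ) ≤ Z ^ 229 := one_le_pow₀ hZ1
    calc _ ≤ 4 * (Z ^ 45) ^ 5 * Z ^ 4 + Z ^ 229 := add_le_add h2 h3
      _ = 5 * Z ^ 229 := by ring
      _ ≤ Z * Z ^ 229 := by gcongr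
      _ = _ := by ring
  have h4 : (M : ℝ) ^ 6 * (q + 1) + 1 ≤ Z ^ 275 := by
    have h2 : (M : ℝ) ^ 6 * (q + 1) ≤ (Z ^ 45) ^ 6 * (Z ^ 4 + Z ^ 4) := by
      gcongr
      exact one_le_pow₀ hZ1
    have h3 : (1 : ℝ) ≤ Z ^ 274 := one_le_pow₀ hZ1
    calc _ ≤ (Z ^ 45) ^ 6 * (Z ^ 4 + Z ^ 4) + Z ^ 274 := add_le_add h2 h3
      _ = 3 * Z ^ 274 := by ring
      _ ≤ Z * Z ^ 274 := by gcongr; linarith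
      _ = _ := by ring
  have h5 : (K : ℝ) + 1 ≤ Z ^ 6 := by
    have h3 : (1 : ℝ) ≤ Z ^ 5 := one_le_pow₀ hZ1
    calc _ ≤ Z ^ 5 + Z ^ 5 := add_le_add hK h3
      _ = 2 * Z ^ 5 := by ring
      _ ≤ Z * Z ^ 5 := by gcongr; linarith
      _ = _ := by ring
  unfold coverSize
  push_cast
  gcongr
  calc _ ≤ Z ^ 13 * (Z ^ 230 * Z ^ 275) * Z ^ 6 := by gcongr
    _ = _ := by ring

/-- A threshold for the counts. -/
theorem exists_threshold {ε δ : ℝ} (hε : 0 < ε) (hε1 : ε < 1) (hδ : 0 < δ) (hδ1 : δ < 1)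
    (hL : 1 / 10 ≤ Real.log (1 / δ)) :
    ∃ T : ℕ, 0 < T ∧ 24 * Real.log (1 + 36 / δ) / ε ≤ T ∧
      (T : ℝ) ≤ 1000 * (Real.log (1 / δ) * (1 / ε)) := by
  have he1 : 1 ≤ 1 / ε := by rw [le_div_iff₀ hε]; linarith
  -- Here 1 + 36/δ ≤ 37/δ and log 37 ≤ 4 ≤ 40 log(1/δ). The lower bound 1/10 on log(1/δ) also
  -- absorbs the rounding of `T`.
  have hlogδ : Real.log (1 + 36 / δ) ≤ 41 * Real.log (1 / δ) := by
    have h1 : 1 + 36 / δ ≤ 37 * (1 / δ) := by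
      have : 1 ≤ 1 / δ := by rw [le_div_iff₀ hδ]; linarith
      calc _ = 1 + 36 * (1 / δ) := by ring
        _ ≤ _ := by linarith
    have h2 : Real.log 37 ≤ 4 := by
      rw [Real.log_le_iff_le_exp (by norm_num)]
      have h3 := Real.exp_one_gt_d9
      have h4 : Real.exp 4 = Real.exp 1 ^ 4 := by rw [← Real.exp_nat_mul]; norm_num
      rw [h4]
      calc (37 : ℝ) ≤ 2.7 ^ 4 := by norm_num
        _ ≤ _ := by gcongr; linarith
    have h5 := Real.log_le_log (by positivity) h1
    rw [Real.log_mul (by norm_num) (by positivity)] at h5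
    linarith
  have hlogδ0 : 0 < Real.log (1 + 36 / δ) :=
    Real.log_pos (by linarith [div_pos (by norm_num : (0 : ℝ) < 36) hδ])
  refine ⟨⌈24 * Real.log (1 + 36 / δ) / ε⌉₊, Nat.ceil_pos.2 (by positivity), Nat.le_ceil _, ?_⟩
  have h1 : (⌈24 * Real.log (1 + 36 / δ) / ε⌉₊ : ℝ) ≤ 24 * Real.log (1 + 36 / δ) / ε + 1 :=
    (Nat.ceil_lt_add_one (by positivity)).le
  have h2 : 24 * Real.log (1 + 36 / δ) / ε ≤ 24 * (41 * Real.log (1 / δ)) * (1 / ε) := by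
    rw [mul_one_div]; gcongr
  have h3 : 1 / 10 ≤ Real.log (1 / δ) * (1 / ε) := by nlinarith
  linarith

/-- The resolutions of the weights and of the grids. -/
theorem exists_resolution {k : ℕ} {α : ℝ} (hk : 1 ≤ k) (hα : 0 < α) (hα1 : α < 1) :
    ∃ K q : ℕ, k ≤ K ∧ 0 < q ∧ (K : ℝ) ≤ 101 * (k * (1 / α)) ∧ (q : ℝ) ≤ 101 * (1 / α) ∧
      (k : ℝ) / K + 2 / q ≤ α / 10 := by
  have hk0 : (1 : ℝ) ≤ k := by exact_mod_cast hk
  have ha1 : 1 ≤ 1 / α := by rw [le_div_iff₀ hα]; linarith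
  obtain ⟨K, hK⟩ : ∃ K, K = ⌈100 * k / α⌉₊ := ⟨_, rfl⟩
  obtain ⟨q, hq⟩ : ∃ q, q = ⌈100 / α⌉₊ := ⟨_, rfl⟩
  have hKlow : 100 * k / α ≤ K := hK ▸ Nat.le_ceil _
  have hqlow : 100 / α ≤ q := hq ▸ Nat.le_ceil _
  have hK0 : (0 : ℝ) < K := lt_of_lt_of_le (by positivity) hKlow
  have hq0 : (0 : ℝ) < q := lt_of_lt_of_le (by positivity) hqlow
  rw [div_le_iff₀ hα] at hKlow hqlow
  refine ⟨K, q, ?_, by exact_mod_cast hq0, ?_, ?_, ?_⟩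
  · have : (k : ℝ) ≤ K := by nlinarith
    exact_mod_cast this
  · have h1 : (K : ℝ) ≤ 100 * k / α + 1 := hK ▸ (Nat.ceil_lt_add_one (by positivity)).le
    have h2 : 1 ≤ k * (1 / α) := by nlinarith
    calc _ ≤ 100 * k / α + 1 := h1
      _ = 100 * (k * (1 / α)) + 1 := by ring
      _ ≤ _ := by linarith
  · have h1 : (q : ℝ) ≤ 100 / α + 1 := hq ▸ (Nat.ceil_lt_add_one (by positivity)).le
    calc _ ≤ 100 / α + 1 := h1
      _ = 100 * (1 / α) + 1 := by ring
      _ ≤ _ := by linarith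
  · have h1 : (k : ℝ) / K ≤ α / 100 := by
      rw [div_le_div_iff₀ hK0 (by norm_num)]
      linarith
    have h2 : 2 / (q : ℝ) ≤ α / 50 := by
      rw [div_le_div_iff₀ hq0 (by norm_num)]
      linarith
    linarith

theorem log_le_mul_log_of_le_pow {y Z : ℝ} (m : ℕ) (hy : 0 < y) (h : y ≤ Z ^ m) :
    Real.log y ≤ m * Real.log Z := by
  have := Real.log_le_log hy h
  rwa [Real.log_pow] at this

/-- The letters a, e, L stand for 1/α, 1/ε and log(1/δ). The crude bound Z^13 feeds the size of the
cover, where only its logarithm counts; the sharp bound enters the sample complexity. -/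
theorem exists_first_size {k K T : ℕ} {Z a e L : ℝ} (hZ : 5 ≤ Z) (hl : 1 ≤ Real.log Z)
    (hk : 1 ≤ k) (hK0 : 0 < K) (ha0 : 0 ≤ a) (he0 : 0 ≤ e) (hL0 : 0 ≤ L)
    (hkZ : (k : ℝ) ≤ Z) (haZ : a ≤ Z) (heZ : e ≤ Z) (hLZ : L ≤ Z) (hT0 : 0 < T)
    (hK : (K : ℝ) ≤ 101 * (k * a)) (hT : (T : ℝ) ≤ 1000 * (L * e)) :
    ∃ n : ℕ, 0 < n ∧ 2 * K * (4 * T + Real.log (40 * k)) ≤ n ∧ (n : ℝ) ≤ Z ^ 13 ∧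
      (n : ℝ) ≤ 808000 * (k * a * (L * e)) + 808 * (k * a * Real.log Z) + 1 := by
  have hk0 : (1 : ℝ) ≤ k := by exact_mod_cast hk
  have hK0' : (0 : ℝ) < K := by exact_mod_cast hK0
  have hT0' : (0 : ℝ) < T := by exact_mod_cast hT0
  have hZ1 : 1 ≤ Z := by linarith
  have hlZ : Real.log Z ≤ Z := (Real.log_le_sub_one_of_pos (by linarith)).trans (by linarith)
  have hlogk : Real.log (40 * k) ≤ 4 * Real.log Z := by
    refine log_le_mul_log_of_le_pow 4 (by positivity) ?_
    calc (40 : ℝ) * k ≤ Z ^ 3 * Z := by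
          gcongr
          calc (40 : ℝ) ≤ 5 ^ 3 := by norm_num
            _ ≤ _ := by gcongr
      _ = _ := by ring
  have hlogk0 : 0 ≤ Real.log (40 * k) := Real.log_nonneg (by linarith)
  obtain ⟨n, hn⟩ : ∃ n, n = ⌈2 * K * (4 * T + Real.log (40 * k))⌉₊ := ⟨_, rfl⟩
  have hup : (n : ℝ) ≤ 808000 * (k * a * (L * e)) + 808 * (k * a * Real.log Z) + 1 := by
    have h1 : (n : ℝ) ≤ 2 * K * (4 * T + Real.log (40 * k)) + 1 :=
      hn ▸ (Nat.ceil_lt_add_one (by positivity)).le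
    have h2 : 2 * K * (4 * T + Real.log (40 * k))
        ≤ 2 * (101 * (k * a)) * (4 * (1000 * (L * e)) + 4 * Real.log Z) := by gcongr
    have h3 : 2 * (101 * (k * a)) * (4 * (1000 * (L * e)) + 4 * Real.log Z)
        = 808000 * (k * a * (L * e)) + 808 * (k * a * Real.log Z) := by ring
    linarith
  refine ⟨n, hn ▸ Nat.ceil_pos.2 (by positivity), hn ▸ Nat.le_ceil _, ?_, hup⟩
  have h1 : k * a * (L * e) ≤ Z * Z * (Z * Z) := by gcongr
  have h2 : k * a * Real.log Z ≤ Z * Z * (Z * Z) := by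
    calc k * a * Real.log Z ≤ Z * Z * (Z * 1) := by rw [mul_one]; gcongr
      _ ≤ _ := by gcongr
  have h3 : 1 ≤ Z * Z * (Z * Z) := by
    calc (1 : ℝ) ≤ Z ^ 4 := one_le_pow₀ hZ1
      _ = _ := by ring
  calc (n : ℝ) ≤ 1000000 * (Z * Z * (Z * Z)) := by linarith
    _ ≤ Z ^ 9 * (Z * Z * (Z * Z)) := by
        gcongr
        calc (1000000 : ℝ) ≤ 5 ^ 9 := by norm_num
          _ ≤ _ := by gcongr
    _ = _ := by ring

/-- The cover size is a k-th power, so its logarithm is at most 524 k log Z, which makes the sample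
size linear in k up to logarithms. -/
theorem exists_second_size {k N : ℕ} {Z α ε : ℝ} (hZ : 5 ≤ Z) (hl : 1 ≤ Real.log Z) (hk : 1 ≤ k)
    (hα : 0 < α) (hε : 0 < ε) (hN0 : 0 < N) (hN : (N : ℝ) ≤ (Z ^ 524) ^ k) :
    ∃ n : ℕ, 0 < n ∧ 20 / (α * ε) * Real.log (40 * N) ≤ n ∧
      50 / α ^ 2 * Real.log (80 * (N : ℝ) ^ 2) ≤ n ∧
      (n : ℝ) ≤ 10540 * (k / (α * ε) * Real.log Z) + 52550 * (k / α ^ 2 * Real.log Z) + 1 := by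
  have hk0 : (1 : ℝ) ≤ k := by exact_mod_cast hk
  have hN0' : (1 : ℝ) ≤ N := by exact_mod_cast hN0
  have h80 : (80 : ℝ) ≤ Z ^ 3 := by
    calc (80 : ℝ) ≤ 5 ^ 3 := by norm_num
      _ ≤ _ := by gcongr
  have hlogN : Real.log N ≤ 524 * (k * Real.log Z) := by
    have := log_le_mul_log_of_le_pow k (by linarith) hN
    rw [Real.log_pow] at this
    push_cast at this
    linarith
  have hkl : Real.log Z ≤ k * Real.log Z := by nlinarith
  have hlog40 : Real.log (40 * N) ≤ 527 * (k * Real.log Z) := by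
    rw [Real.log_mul (by norm_num) (by linarith)]
    have := log_le_mul_log_of_le_pow (y := 40) (Z := Z) 3 (by norm_num) (by linarith)
    push_cast at this
    linarith
  have hlog80 : Real.log (80 * (N : ℝ) ^ 2) ≤ 1051 * (k * Real.log Z) := by
    rw [Real.log_mul (by norm_num) (by positivity), Real.log_pow]
    have := log_le_mul_log_of_le_pow (y := 80) 3 (by norm_num) h80
    push_cast at this ⊢
    linarith
  have hr₁ : 0 < 20 / (α * ε) * Real.log (40 * N) :=
    mul_pos (by positivity) (Real.log_pos (by linarith))
  have hr₂ : 0 < 50 / α ^ 2 * Real.log (80 * (N : ℝ) ^ 2) :=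
    mul_pos (by positivity) (Real.log_pos (by nlinarith))
  have hu₁ : 20 / (α * ε) * Real.log (40 * N) ≤ 10540 * (k / (α * ε) * Real.log Z) := by
    calc _ ≤ 20 / (α * ε) * (527 * (k * Real.log Z)) := by gcongr
      _ = _ := by ring
  have hu₂ : 50 / α ^ 2 * Real.log (80 * (N : ℝ) ^ 2) ≤ 52550 * (k / α ^ 2 * Real.log Z) := by
    calc _ ≤ 50 / α ^ 2 * (1051 * (k * Real.log Z)) := by gcongr
      _ = _ := by ring
  generalize 20 / (α * ε) * Real.log (40 * N) = r₁ at *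
  generalize 50 / α ^ 2 * Real.log (80 * (N : ℝ) ^ 2) = r₂ at *
  have h1 : r₁ + r₂ ≤ ⌈r₁ + r₂⌉₊ := Nat.le_ceil _
  have h2 : (⌈r₁ + r₂⌉₊ : ℝ) < r₁ + r₂ + 1 := Nat.ceil_lt_add_one (by positivity)
  exact ⟨⌈r₁ + r₂⌉₊, Nat.ceil_pos.2 (by positivity), by linarith, by linarith, by linarith⟩

/-- Learning with small failure probability, for `δ` bounded away from one. -/
theorem exists_learner_of_le {k : ℕ} {α ε δ : ℝ} (hk : 1 ≤ k) (hα : 0 < α) (hα1 : α < 1)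
    (hε : 0 < ε) (hε1 : ε < 1) (hδ : 0 < δ) (hδ1 : δ ≤ 9 / 10) :
    ∃ n : ℕ, (n : ℝ) ≤ 2000000 * (k / α ^ 2 + k * Real.log (1 / δ) / (α * ε)) *
        Real.log (logArg k α ε δ) ∧
      ∃ A : Kernel (Fin n → ℝ) (GMM k), IsMarkovKernel A ∧ IsDP A ε δ ∧
        ∀ D : GMM k, ((Measure.pi fun _ : Fin n => D.law).bind A)
          {H | α < GMM.tvDist H D} ≤ 1 / 8 := by
  have hk0 : (1 : ℝ) ≤ k := by exact_mod_cast hk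
  have ha1 : 1 ≤ 1 / α := by rw [le_div_iff₀ hα]; linarith
  have he1 : 1 ≤ 1 / ε := by rw [le_div_iff₀ hε]; linarith
  have hL : 1 / 10 ≤ Real.log (1 / δ) := by
    rw [one_div δ, Real.log_inv]
    have := Real.log_le_sub_one_of_pos hδ
    linarith
  have hZeq : logArg k α ε δ = 2 + k + 1 / α + 1 / ε + Real.log (1 / δ) := rfl
  obtain ⟨T, hT0, hTlow, hTup⟩ := exists_threshold hε hε1 hδ (by linarith) hL
  generalize logArg k α ε δ = Z at *
  obtain ⟨K, q, hkK, hq0, hKup, hqup, hKq⟩ := exists_resolution hk hα hα1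
  have hZ5 : 5 ≤ Z := by linarith
  have hkZ : (k : ℝ) ≤ Z := by linarith
  have haZ : 1 / α ≤ Z := by linarith
  have hl1 : 1 ≤ Real.log Z := by
    rw [Real.le_log_iff_exp_le (by linarith)]
    linarith [Real.exp_one_lt_d9]
  obtain ⟨n₁, hn₁0, hn₁low, hn₁Z, hn₁up⟩ := exists_first_size hZ5 hl1 hk (hk.trans hkK)
    (by linarith) (by linarith) (by linarith) hkZ haZ (by linarith : 1 / ε ≤ Z)
    (by linarith : Real.log (1 / δ) ≤ Z) hT0 hKup hTup
  have h101 : (101 : ℝ) ≤ Z ^ 3 := by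
    calc (101 : ℝ) ≤ 5 ^ 3 := by norm_num
      _ ≤ _ := by gcongr
  have hMZ : ((10000 * n₁ ^ 3 : ℕ) : ℝ) ≤ Z ^ 45 := by
    push_cast
    calc 10000 * (n₁ : ℝ) ^ 3 ≤ Z ^ 6 * (Z ^ 13) ^ 3 := by
          gcongr
          calc (10000 : ℝ) ≤ 5 ^ 6 := by norm_num
            _ ≤ _ := by gcongr
      _ = _ := by ring
  have hqZ : (q : ℝ) ≤ Z ^ 4 := by
    calc (q : ℝ) ≤ 101 * (1 / α) := hqup
      _ ≤ Z ^ 3 * Z := by gcongr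
      _ = _ := by ring
  have hKZ : (K : ℝ) ≤ Z ^ 5 := by
    calc (K : ℝ) ≤ 101 * (k * (1 / α)) := hKup
      _ ≤ Z ^ 3 * (Z * Z) := by gcongr
      _ = _ := by ring
  have hN0 : 0 < coverSize k K (10000 * n₁ ^ 3) q n₁ := by
    unfold coverSize
    positivity
  obtain ⟨n₂, hn₂0, hn₂a, hn₂b, hn₂up⟩ := exists_second_size hZ5 hl1 hk hα hε hN0
    (coverSize_le hZ5 hn₁Z hMZ hqZ hKZ)
  refine ⟨n₁ + n₂, ?_, exists_learner hk hkK le_rfl hq0 hα hε hε1.le hδ hn₁0 hn₂0 hKq hT0 hTlow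
    hn₁low hn₂a hn₂b⟩
  have hV : k * (1 / α) * (Real.log (1 / δ) * (1 / ε)) = k * Real.log (1 / δ) / (α * ε) := by
    field_simp
  have hU1 : 1 ≤ (k : ℝ) / α ^ 2 := by
    rw [le_div_iff₀ (by positivity), one_mul]
    exact (pow_le_one₀ hα.le hα1.le).trans hk0
  have hkα : k * (1 / α) ≤ k / α ^ 2 := by
    rw [mul_one_div]
    gcongr
    exact pow_le_of_le_one hα.le hα1.le two_ne_zero
  -- Selection costs k/(αε) without the factor log(1/δ); it is absorbed because log(1/δ) ≥ 1/10.
  have hkε : k / (α * ε) ≤ 10 * (k * Real.log (1 / δ) / (α * ε)) := by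
    rw [← mul_div_assoc]
    gcongr
    linarith [mul_le_mul_of_nonneg_left hL (by linarith : (0 : ℝ) ≤ k)]
  have hV0 : 0 ≤ k * Real.log (1 / δ) / (α * ε) := by positivity
  rw [hV] at hn₁up
  have h1 := mul_le_mul_of_nonneg_right hkα (by linarith : 0 ≤ Real.log Z)
  have h2 := mul_le_mul_of_nonneg_right hkε (by linarith : 0 ≤ Real.log Z)
  have h3 := mul_le_mul_of_nonneg_left hl1 hV0
  have h4 := mul_le_mul hU1 hl1 zero_le_one (by linarith)
  push_cast
  rw [mul_assoc, add_mul]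
  linarith

/-! ### The final theorem, including δ close to one -/

theorem learnsGMM_of_le {k n : ℕ} {A : Kernel (Fin n → ℝ) (GMM k)} [IsMarkovKernel A] {α β : ℝ}
    (hβ : 0 ≤ β) (h : ∀ D : GMM k, ((Measure.pi fun _ : Fin n => D.law).bind A)
      {H | α < GMM.tvDist H D} ≤ ENNReal.ofReal β) : LearnsGMM A α β := by
  intro D
  have hS : MeasurableSet {H : GMM k | GMM.tvDist H D ≤ α} :=
    measurableSet_le (GMM.measurable_tvDist D) measurable_const
  have hc : {H : GMM k | α < GMM.tvDist H D} = {H : GMM k | GMM.tvDist H D ≤ α}ᶜ := by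
    ext H; simp
  have hD := h D
  rw [hc, prob_compl_eq_one_sub hS, tsub_le_iff_left] at hD
  rw [ENNReal.ofReal_sub _ hβ, ENNReal.ofReal_one, tsub_le_iff_right]
  exact hD

/-- Running an arbitrary algorithm with probability `δ` and ignoring the data otherwise
preserves privacy. -/
theorem exists_isDP_mixture {k n : ℕ} (A : Kernel (Fin n → ℝ) (GMM k)) [IsMarkovKernel A]
    (hk : 0 < k) {ε δ : ℝ} (hε : 0 ≤ ε) (hδ0 : 0 ≤ δ) (hδ1 : δ ≤ 1) :
    ∃ A' : Kernel (Fin n → ℝ) (GMM k), IsMarkovKernel A' ∧ IsDP A' ε δ ∧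
      ∀ x S, A' x S ≤ A x S + ENNReal.ofReal (1 - δ) := by
  obtain ⟨H⟩ := GMM.nonempty hk
  let A' : Kernel (Fin n → ℝ) (GMM k) :=
    ⟨fun x => ENNReal.ofReal δ • A x + ENNReal.ofReal (1 - δ) • Measure.dirac H, by
      refine Measure.measurable_of_measurable_coe _ fun S hS => ?_
      simp only [Measure.add_apply, Measure.smul_apply, smul_eq_mul]
      exact ((A.measurable_coe hS).const_mul _).add measurable_const⟩
  have happ : ∀ x S, A' x S
      = ENNReal.ofReal δ * A x S + ENNReal.ofReal (1 - δ) * Measure.dirac H S := fun x S => rfl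
  have hδ1' : ENNReal.ofReal δ ≤ 1 := ENNReal.ofReal_le_one.2 hδ1
  refine ⟨A', ⟨fun x => ⟨?_⟩⟩, fun x x' _ S _ => ?_, fun x S => ?_⟩
  · rw [happ, measure_univ, measure_univ, mul_one, mul_one,
      ← ENNReal.ofReal_add hδ0 (by linarith), add_sub_cancel, ENNReal.ofReal_one]
  · rw [happ, happ]
    calc _ ≤ ENNReal.ofReal δ * 1 + 1 * (ENNReal.ofReal (1 - δ) * Measure.dirac H S) := by
          rw [one_mul]; gcongr; exact prob_le_one
      _ ≤ ENNReal.ofReal δ + ENNReal.ofReal (Real.exp ε) * (ENNReal.ofReal δ * A x S +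
            ENNReal.ofReal (1 - δ) * Measure.dirac H S) := by
          rw [mul_one]
          gcongr
          · exact ENNReal.one_le_ofReal.2 (Real.one_le_exp hε)
          · exact le_add_self
      _ = _ := add_comm _ _
  · rw [happ]
    gcongr
    · exact mul_le_of_le_one_left zero_le hδ1'
    · exact mul_le_of_le_one_right zero_le prob_le_one

theorem mainTheorem2 :
    ∃ C c : ℝ, 0 < C ∧ 0 < c ∧
      ∀ (k : ℕ) (α ε δ : ℝ), 1 ≤ k → 0 < α → α < 1 → 0 < ε → ε < 1 → 0 < δ → δ < 1 →
        ∃ n : ℕ,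
          (n : ℝ) ≤ C * (k / α ^ 2 + k * Real.log (1 / δ) / (α * ε)) *
              Real.log (2 + k + 1 / α + 1 / ε + Real.log (1 / δ)) ^ c ∧
          ∃ A : Kernel (Fin n → ℝ) (GMM k),
            IsMarkovKernel A ∧ IsDP A ε δ ∧ LearnsGMM A α (1 / 3) := by
  refine ⟨12000000, 1, by norm_num, one_pos, fun k α ε δ hk hα hα1 hε hε1 hδ hδ1 => ?_⟩
  rw [Real.rpow_one]
  have hk0 : (1 : ℝ) ≤ k := by exact_mod_cast hk
  have ha1 : 1 ≤ 1 / α := by rw [le_div_iff₀ hα]; linarith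
  have he1 : 1 ≤ 1 / ε := by rw [le_div_iff₀ hε]; linarith
  have hL0 : 0 ≤ Real.log (1 / δ) := Real.log_nonneg (by rw [le_div_iff₀ hδ]; linarith)
  set Z := 2 + k + 1 / α + 1 / ε + Real.log (1 / δ) with hZ
  have hZ5 : 5 ≤ Z := by linarith
  have hl0 : 0 ≤ Real.log Z := Real.log_nonneg (by linarith)
  have hV0 : 0 ≤ k * Real.log (1 / δ) / (α * ε) := by positivity
  have hU0 : 0 ≤ k / α ^ 2 := by positivity
  have h3 : ENNReal.ofReal (1 / 3) = 1 / 3 := by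
    rw [ENNReal.ofReal_div_of_pos (by norm_num)]; simp
  rcases le_or_gt δ (9 / 10) with hδ9 | hδ9
  · obtain ⟨n, hn, A, hA, hdp, hacc⟩ := exists_learner_of_le hk hα hα1 hε hε1 hδ hδ9
    refine ⟨n, hn.trans ?_, A, hA, hdp, learnsGMM_of_le (by norm_num) fun D => (hacc D).trans ?_⟩
    · change 2000000 * _ * Real.log Z ≤ _
      gcongr
      norm_num
    · rw [h3, one_div, one_div, ENNReal.inv_le_inv]
      norm_num
  -- As δ tends to 1 the privacy term of the bound vanishes, so the learner is taken at ε = δ = 1/2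
  -- and its own privacy is discarded. The mixture fails with probability at most 1/8 + 1/10 < 1/3.
  · obtain ⟨n, hn, A, hA, -, hacc⟩ := exists_learner_of_le (k := k) (α := α) (ε := 1 / 2)
      (δ := 1 / 2) hk hα hα1 (by norm_num) (by norm_num) (by norm_num) (by norm_num)
    obtain ⟨A', hA', hdp, hle⟩ := exists_isDP_mixture A hk (ε := ε) hε.le hδ.le hδ1.le
    refine ⟨n, ?_, A', hA', hdp, learnsGMM_of_le (by norm_num) fun D => ?_⟩
    · have hlog2 := Real.log_two_lt_d9
      have hlog20 : 0 < Real.log 2 := Real.log_pos (by norm_num)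
      -- Squaring the argument costs a factor 2 in the logarithm. The fixed privacy term is at most
      -- 2k/α², so the constant becomes 2000000 · 3 · 2.
      have harg : logArg k α (1 / 2) (1 / 2) ≤ Z ^ 2 := by
        have : logArg k α (1 / 2) (1 / 2) = 2 + k + 1 / α + 2 + Real.log 2 := by
          unfold logArg; norm_num
        nlinarith
      have harg0 : 0 < logArg k α (1 / 2) (1 / 2) := by
        unfold logArg
        norm_num
        positivity
      have hlog := Real.log_le_log harg0 harg
      rw [Real.log_pow] at hlog
      push_cast at hlog
      have hV : k * Real.log (1 / (1 / 2)) / (α * (1 / 2)) ≤ 2 * (k / α ^ 2) := by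
        rw [one_div_one_div]
        have h1 : k * Real.log 2 / (α * (1 / 2)) ≤ k * 1 / (α * (1 / 2)) := by gcongr; linarith
        have h2 : k * 1 / (α * (1 / 2)) = 2 * (k / α) := by field_simp
        have h4 : (k : ℝ) / α ≤ k / α ^ 2 := by gcongr; nlinarith
        linarith
      calc (n : ℝ) ≤ _ := hn
        _ ≤ 2000000 * (k / α ^ 2 + k * Real.log (1 / (1 / 2)) / (α * (1 / 2))) *
            (2 * Real.log Z) := by
            refine mul_le_mul_of_nonneg_left hlog ?_
            rw [one_div_one_div]
            positivity
        _ ≤ 2000000 * (k / α ^ 2 + 2 * (k / α ^ 2)) * (2 * Real.log Z) := by gcongr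
        _ = 12000000 * (k / α ^ 2) * Real.log Z := by ring
        _ ≤ _ := by gcongr; linarith
    · have hS : MeasurableSet {H : GMM k | α < GMM.tvDist H D} :=
        measurableSet_lt measurable_const (GMM.measurable_tvDist D)
      have hD := hacc D
      rw [Measure.bind_apply hS (Kernel.aemeasurable _)] at hD ⊢
      calc _ ≤ ∫⁻ x, (A x {H | α < GMM.tvDist H D} + ENNReal.ofReal (1 / 10))
            ∂(Measure.pi fun _ : Fin n => D.law) := by
            refine lintegral_mono fun x => (hle x _).trans ?_
            gcongr
            linarith
        _ ≤ 1 / 8 + ENNReal.ofReal (1 / 10) := by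
            rw [lintegral_add_right _ measurable_const, lintegral_const, measure_univ, mul_one]
            gcongr
        _ ≤ _ := by
            have h8 : (1 : ℝ≥0∞) / 8 = ENNReal.ofReal (1 / 8) := by
              rw [ENNReal.ofReal_div_of_pos (by norm_num)]; simp
            rw [h8, ← ENNReal.ofReal_add (by norm_num) (by norm_num)]
            exact ENNReal.ofReal_le_ofReal (by norm_num)
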